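/- **Setting.** Let $\mathcal C_1=NC$ be the category of non-crossing partitions: its objects are the integers $m\ge 0$; a morphism $m\to n$ is a non-crossing partition of an upper row of $m$ points and a lower row of $n$ points; diagrams are composed by stacking them vertically, identifying the middle points and deleting every block that is not connected to an outer row. Inductively, for $k\ge 1$, the objects of $\mathcal C_{k+1}$ are the tuples $(m;\alpha_1,\dots,\alpha_m)$ with $m\ge 0$ and $\alpha_1,\dots,\alpha_m$ objects of $\mathcal C_k$. A morphism $(m;\alpha_1,\dots,\alpha_m)\to(n;\beta_1,\dots,\beta_n)$ of $\mathcal C_{k+1}$ is a tuple $(p;\varphi_1,\dots,\varphi_l)$, where $p=\{B_1,\dots,B_l\}$ is a non-crossing partition of $m$ upper and $n$ lower points and $\varphi_i$ is a morphism of $\mathcal C_k$ from the tensor product of the $\alpha_j$ with $j$ an upper point of $B_i$ to the tensor product of the $\beta_j$ with $j$ a lower point of $B_i$ (both from left to right). Equivalently, it is a nesting of $k+1$ levels of non-crossing partitions, each level contained in the one above. Composition is stacking at every level: the middle objects are identified, and every block without connection to the upper or lower openings is deleted. The tensor product $\otimes$ of objects and of morphisms is horizontal juxtaposition, with unit object $\mathbb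 1=0\in\mathcal C_1$, respectively $\mathbb 1=(0;)\in\mathcal C_{k+1}$; the adjoint $\rho^*$ of a morphism $\rho$ is its reflection in a horizontal axis. For an object $\alpha$ of $\mathcal C_k$ put $\Psi(\alpha)=(1;\alpha)$, and for a morphism $\varphi:\alpha\to\beta$ of $\mathcal C_k$ put $\Psi(\varphi)=(\mathrm{id}_1;\varphi):\Psi(\alpha)\to\Psi(\beta)$. For objects $\alpha,\beta$ of $\mathcal C_k$ let $P_{\alpha,\beta}=(p;\mathrm{id}_{\alpha\otimes\beta}):\Psi(\alpha\otimes\beta)\to\Psi(\alpha)\otimes\Psi(\beta)$, where $p$ is the one-block partition on one upper and two lower points. Let $c=(q;\mathrm{id}_{\mathbb 1}):\mathbb 1\to\Psi(\mathbb 1)$, where $q$ is the one-block partition on no upper and one lower point; this is the one-point cap partition, regarded as a morphism of $\mathcal C_{k+1}$. **Proposition.** For every $k\ge 1$ the category $\mathcal C_{k+1}$ is generated by $$\{\Psi(\varphi):\varphi\in\operatorname{Hom}(\mathcal C_k)\}\ \cup\ \{P_{\alpha,\beta}:\alpha,\beta\in\mathcal C_k\}\ \cup\ \{c\},$$ that is,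 every morphism of $\mathcal C_{k+1}$ can be obtained from these morphisms by finitely many compositions, tensor products and adjoints. -/

import Mathlib

open CategoryTheory

namespace Tubular

/-! ### Non-crossing partitions with rows of upper and lower points -/

section NC

variable {A B C D : Type}

/-- The order in which the points of a diagram with upper row `A` and lower row `B` are met when one
walks around it: first the upper row from left to right, then the lower row from right to left. -/
def Before [LT A] [LT B] : A ⊕ B → A ⊕ B → Prop
  | .inl x, .inl y => x < y
  | .inl _, .inr _ => True
  | .inr _, .inl _ => False
  | .inr x, .inr y => y < x

/-- A non-crossing partition of the upper row `A` and the lower row `B`; the blocks are the classes of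
`rel`. With `A = Fin m` and `B = Fin n` these are the elements of `NC(m, n)`. -/
@[ext]
structure NCPart (A B : Type) [LinearOrder A] [LinearOrder B] where
  rel : Setoid (A ⊕ B)
  noncrossing : ∀ w x y z : A ⊕ B, Before w x → Before x y → Before y z →
    rel w y → rel x z → rel w x

theorem Before.trichotomy [LinearOrder A] [LinearOrder B] (x y : A ⊕ B) :
    Before x y ∨ x = y ∨ Before y x := by
  rcases x with x | x <;> rcases y with y | y <;> simp only [Before, Sum.inl.injEq, Sum.inr.injEq,
    true_or, or_true]
  · exact lt_trichotomy x y
  · rcases lt_trichotomy x y with h | h | h <;> simp [h]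

theorem Before.asymm [LinearOrder A] [LinearOrder B] {x y : A ⊕ B} (h : Before x y) :
    ¬ Before y x := by
  rcases x with x | x <;> rcases y with y | y <;> simp_all [Before, le_of_lt]

theorem Before.trans [LinearOrder A] [LinearOrder B] {x y z : A ⊕ B} (h : Before x y)
    (h' : Before y z) : Before x z := by
  rcases x with x | x <;> rcases y with y | y <;> rcases z with z | z <;>
    simp_all [Before] <;> order

variable [LinearOrder A] [LinearOrder B] [LinearOrder C] [LinearOrder D]

namespace NCPart

/-- The partition with a single block. -/
def oneBlock : NCPart A B where
  rel := ⊤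
  noncrossing _ _ _ _ _ _ _ _ _ := trivial

/-- The identity partition: every upper point is joined to the lower point below it. -/
def id : NCPart A A where
  rel := Setoid.ker (Sum.elim (fun a : A => a) (fun a : A => a))
  noncrossing := by
    intro w x y z h1 h2 h3 h h'
    rcases w with w | w <;> rcases x with x | x <;> rcases y with y | y <;> rcases z with z | z <;>
      simp_all [Before] <;> order

/-- The adjoint: reflection in a horizontal axis. -/
def adj (p : NCPart A B) : NCPart B A where
  rel := Setoid.comap Sum.swap p.rel
  noncrossing := by
    have key : ∀ x y : B ⊕ A, Before x y → Before y.swap x.swap := by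
      rintro (x | x) (y | y) h <;> simp_all [Before]
    intro w x y z h1 h2 h3 h h'
    have h := p.rel.symm h
    have h' := p.rel.symm h'
    have := p.noncrossing _ _ _ _ (key _ _ h3) (key _ _ h2) (key _ _ h1) h' h
    exact p.rel.trans (p.rel.symm h) (p.rel.trans (p.rel.symm this) h')

/-- Transport of a partition along an order-preserving labelling of the points. -/
def comap (p : NCPart A B) (f : C → A) (g : D → B) (hf : StrictMono f) (hg : StrictMono g) :
    NCPart C D where
  rel := Setoid.comap (Sum.map f g) p.rel
  noncrossing := by
    have key : ∀ x y : C ⊕ D, Before x y → Before (x.map f g) (y.map f g) := by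
      rintro (x | x) (y | y) h <;> simp_all [Before, hf.lt_iff_lt, hg.lt_iff_lt]
    intro w x y z h1 h2 h3 h h'
    exact p.noncrossing _ _ _ _ (key _ _ h1) (key _ _ h2) (key _ _ h3) h h'

/-- The disjoint union of two partitions. -/
def sumSetoid {X Y : Type} (r : Setoid X) (s : Setoid Y) : Setoid (X ⊕ Y) where
  r := Sum.LiftRel r s
  iseqv :=
    { refl := by rintro (x | x) <;> constructor <;> apply Setoid.refl'
      symm := by rintro _ _ (⟨h⟩ | ⟨h⟩) <;> constructor <;> exact Setoid.symm' _ h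
      trans := by
        rintro _ _ _ (⟨h⟩ | ⟨h⟩) (⟨h'⟩ | ⟨h'⟩) <;> constructor <;> exact Setoid.trans' _ h h' }

/-- Sorts the points of two horizontally adjacent diagrams into the left and the right diagram. -/
def regroup {A B C D : Type} : (A ⊕ₗ C) ⊕ (B ⊕ₗ D) → (A ⊕ B) ⊕ (C ⊕ D) :=
  Sum.elim (fun x => (ofLex x).map .inl .inl) (fun x => (ofLex x).map .inr .inr)

theorem lex_cases {A B C D : Type} (x : (A ⊕ₗ C) ⊕ (B ⊕ₗ D)) :
    (∃ a, x = .inl (toLex (.inl a)) ∧ regroup x = .inl (.inl a)) ∨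
    (∃ a, x = .inl (toLex (.inr a)) ∧ regroup x = .inr (.inl a)) ∨
    (∃ a, x = .inr (toLex (.inl a)) ∧ regroup x = .inl (.inr a)) ∨
    (∃ a, x = .inr (toLex (.inr a)) ∧ regroup x = .inr (.inr a)) := by
  rcases x with (x | x) | (x | x)
  · exact .inl ⟨x, rfl, rfl⟩
  · exact .inr (.inl ⟨x, rfl, rfl⟩)
  · exact .inr (.inr (.inl ⟨x, rfl, rfl⟩))
  · exact .inr (.inr (.inr ⟨x, rfl, rfl⟩))

theorem regroup_inl {x y : (A ⊕ₗ C) ⊕ (B ⊕ₗ D)} {a b : A ⊕ B} (h : Before x y)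
    (hx : regroup x = .inl a) (hy : regroup y = .inl b) : Before a b := by
  rcases lex_cases x with ⟨u, rfl, e⟩ | ⟨u, rfl, e⟩ | ⟨u, rfl, e⟩ | ⟨u, rfl, e⟩ <;>
    rcases lex_cases y with ⟨v, rfl, e'⟩ | ⟨v, rfl, e'⟩ | ⟨v, rfl, e'⟩ | ⟨v, rfl, e'⟩ <;>
    rw [e] at hx <;> rw [e'] at hy <;> cases hx <;> cases hy <;>
    simp [Before] at h ⊢ <;> exact h

theorem regroup_inr {x y : (A ⊕ₗ C) ⊕ (B ⊕ₗ D)} {a b : C ⊕ D} (h : Before x y)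
    (hx : regroup x = .inr a) (hy : regroup y = .inr b) : Before a b := by
  rcases lex_cases x with ⟨u, rfl, e⟩ | ⟨u, rfl, e⟩ | ⟨u, rfl, e⟩ | ⟨u, rfl, e⟩ <;>
    rcases lex_cases y with ⟨v, rfl, e'⟩ | ⟨v, rfl, e'⟩ | ⟨v, rfl, e'⟩ | ⟨v, rfl, e'⟩ <;>
    rw [e] at hx <;> rw [e'] at hy <;> cases hx <;> cases hy <;>
    simp [Before] at h ⊢ <;> exact h

theorem regroup_between {x y z : (A ⊕ₗ C) ⊕ (B ⊕ₗ D)} {a b : C ⊕ D} (h : Before x y)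
    (h' : Before y z) (hx : regroup x = .inr a) (hz : regroup z = .inr b) :
    ∃ c, regroup y = .inr c := by
  rcases lex_cases x with ⟨u, rfl, e⟩ | ⟨u, rfl, e⟩ | ⟨u, rfl, e⟩ | ⟨u, rfl, e⟩ <;>
    rcases lex_cases y with ⟨v, rfl, e'⟩ | ⟨v, rfl, e'⟩ | ⟨v, rfl, e'⟩ | ⟨v, rfl, e'⟩ <;>
    rcases lex_cases z with ⟨w, rfl, e''⟩ | ⟨w, rfl, e''⟩ | ⟨w, rfl, e''⟩ | ⟨w, rfl, e''⟩ <;>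
    rw [e] at hx <;> rw [e''] at hz <;> cases hx <;> cases hz <;> simp_all [Before]

/-- The tensor product: horizontal juxtaposition. -/
def tensor (p : NCPart A B) (q : NCPart C D) : NCPart (A ⊕ₗ C) (B ⊕ₗ D) where
  rel := Setoid.comap regroup (sumSetoid p.rel q.rel)
  noncrossing := by
    intro w x y z h1 h2 h3 h h'
    change Sum.LiftRel p.rel q.rel (regroup w) (regroup y) at h
    change Sum.LiftRel p.rel q.rel (regroup x) (regroup z) at h'
    change Sum.LiftRel p.rel q.rel (regroup w) (regroup x)
    rcases hw : regroup w with w' | w' <;> rcases hx : regroup x with x' | x' <;>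
      rcases hy : regroup y with y' | y' <;> rcases hz : regroup z with z' | z' <;>
      rw [hw, hy] at h <;> rw [hx, hz] at h' <;>
      rcases h with ⟨h⟩ | ⟨h⟩ <;> rcases h' with ⟨h'⟩ | ⟨h'⟩
    · exact .inl (p.noncrossing _ _ _ _ (regroup_inl h1 hw hx) (regroup_inl h2 hx hy)
        (regroup_inl h3 hy hz) h h')
    · obtain ⟨c, hc⟩ := regroup_between h2 h3 hx hz
      simp [hc] at hy
    · obtain ⟨c, hc⟩ := regroup_between h1 h2 hw hy
      simp [hc] at hx
    · exact .inr (q.noncrossing _ _ _ _ (regroup_inr h1 hw hx) (regroup_inr h2 hx hy)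
        (regroup_inr h3 hy hz) h h')

/-! Composition. The three rows of the vertical stack of `p : NCPart A B` and `q : NCPart B C` are
`A`, `B`, `C`. -/

/-- The upper two rows of a stack. -/
def upper {A B C : Type} : A ⊕ B → A ⊕ B ⊕ C := Sum.map _root_.id .inl

/-- The outer two rows of a stack. -/
def outer {A B C : Type} : A ⊕ C → A ⊕ B ⊕ C := Sum.map _root_.id .inr

/-- Two points of the stack are linked if they lie in a common block of one of the two diagrams. -/
inductive Linked (p : Setoid (A ⊕ B)) (q : Setoid (B ⊕ C)) : A ⊕ B ⊕ C → A ⊕ B ⊕ C → Prop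
  | top {x y : A ⊕ B} (h : p x y) : Linked p q (upper x) (upper y)
  | bot {x y : B ⊕ C} (h : q x y) : Linked p q (.inr x) (.inr y)

/-- The blocks of the whole stack. -/
def stack (p : Setoid (A ⊕ B)) (q : Setoid (B ⊕ C)) : Setoid (A ⊕ B ⊕ C) :=
  Relation.EqvGen.setoid (Linked p q)

/-- The indicator of a proposition, modulo two. -/
noncomputable def ind (P : Prop) : ZMod 2 := open Classical in if P then 1 else 0

theorem ind_of {P : Prop} (h : P) : ind P = 1 := if_pos h

theorem ind_of_not {P : Prop} (h : ¬ P) : ind P = 0 := if_neg h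

@[simp] theorem ind_true : ind True = 1 := ind_of trivial

@[simp] theorem ind_false : ind False = 0 := ind_of_not not_false

/-- The contribution of an endpoint `v` of a path of the stack to the parity with which this path
separates the point `m` of the middle row from the left boundary. -/
noncomputable def midParity (v : A ⊕ B ⊕ C) (m : B) : ZMod 2 :=
  match v with
  | .inl _ => 1
  | .inr (.inl b) => ind (m < b)
  | .inr (.inr _) => 1

/-- The contribution of an endpoint `v` of a path of the stack to the parity with which this path
separates the point `x` of an outer row from the left boundary. -/
noncomputable def outerParity (v : A ⊕ B ⊕ C) (x : A ⊕ C) : ZMod 2 :=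
  match v, x with
  | .inl a, .inl x => ind (a < x)
  | .inr _, .inl _ => 0
  | .inl _, .inr _ => 1
  | .inr (.inl _), .inr _ => 1
  | .inr (.inr c), .inr x => ind (x < c)

theorem chord_eq (p : NCPart A B) {u v a b : A ⊕ B} (huv : p.rel u v) (hab : p.rel a b)
    (hua : ¬ p.rel u a) :
    ind (Before u a) + ind (Before v a) = ind (Before u b) + ind (Before v b) := by
  have key : ∀ u v a b : A ⊕ B, p.rel u v → p.rel a b → ¬ p.rel u a → Before u a → Before a v →
      Before u b ∧ Before b v := by
    intro u v a b huv hab hua h1 h2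
    have hub : ¬ p.rel u b := fun h => hua (p.rel.trans h (p.rel.symm hab))
    constructor
    · rcases Before.trichotomy u b with h | rfl | h
      · exact h
      · exact absurd (p.rel.refl _) hub
      · have := p.noncrossing _ _ _ _ h h1 h2 (p.rel.symm hab) huv
        exact absurd (p.rel.symm this) hub
    · rcases Before.trichotomy b v with h | rfl | h
      · exact h
      · exact absurd huv hub
      · exact absurd (p.noncrossing _ _ _ _ h1 h2 h huv hab) hua
  have hva : ¬ p.rel v a := fun h => hua (p.rel.trans huv h)
  have hub : ¬ p.rel u b := fun h => hua (p.rel.trans h (p.rel.symm hab))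
  have hvb : ¬ p.rel v b := fun h => hub (p.rel.trans huv h)
  have split : ∀ a : A ⊕ B, ¬ p.rel u a → ¬ p.rel v a → ind (Before u a) + ind (Before v a) =
      ind ((Before u a ∧ Before a v) ∨ (Before v a ∧ Before a u)) := by
    intro a hua hva
    have two : (1 + 1 : ZMod 2) = 0 := rfl
    rcases Before.trichotomy u a with h | rfl | h
    · rcases Before.trichotomy v a with h' | rfl | h'
      · rw [ind_of h, ind_of h', ind_of_not (by have := h.asymm; have := h'.asymm; tauto), two]
      · exact absurd (p.rel.refl _) hva
      · rw [ind_of h, ind_of_not h'.asymm, ind_of (by tauto), add_zero]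
    · exact absurd (p.rel.refl _) hua
    · rcases Before.trichotomy v a with h' | rfl | h'
      · rw [ind_of_not h.asymm, ind_of h', ind_of (by tauto), zero_add]
      · exact absurd (p.rel.refl _) hva
      · rw [ind_of_not h.asymm, ind_of_not h'.asymm,
          ind_of_not (by have := h.asymm; have := h'.asymm; tauto), add_zero]
  rw [split a hua hva, split b hub hvb]
  congr 1
  apply propext
  constructor
  · rintro (⟨h, h'⟩ | ⟨h, h'⟩)
    · exact .inl (key _ _ _ _ huv hab hua h h')
    · exact .inr (key _ _ _ _ (p.rel.symm huv) hab hva h h')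
  · rintro (⟨h, h'⟩ | ⟨h, h'⟩)
    · exact .inl (key _ _ _ _ huv (p.rel.symm hab) hub h h')
    · exact .inr (key _ _ _ _ (p.rel.symm huv) (p.rel.symm hab) hvb h h')

/-- The parity with which a path of the stack separates points from the left boundary. -/
theorem exists_potential (p : NCPart A B) (q : NCPart B C) (K : A ⊕ B ⊕ C → Prop)
    (hK : ∀ u v, Linked p.rel q.rel u v → (K u ↔ K v)) {u v : A ⊕ B ⊕ C}
    (huv : stack p.rel q.rel u v) :
    (K u ↔ K v) ∧ (K u → ∃ (f : A ⊕ B → ZMod 2) (g : B ⊕ C → ZMod 2),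
      (∀ a b, p.rel a b → ¬ K (upper a) → f a = f b) ∧
      (∀ a b, q.rel a b → ¬ K (.inr a) → g a = g b) ∧
      (∀ m : B, ¬ K (.inr (.inl m)) → f (.inr m) + g (.inl m) = midParity u m + midParity v m) ∧
      (∀ a : A, f (.inl a) = outerParity u (.inl a) + outerParity v (.inl a)) ∧
      (∀ c : C, g (.inr c) = outerParity u (.inr c) + outerParity v (.inr c))) := by
  have two : (1 + 1 : ZMod 2) = 0 := rfl
  have dbl : ∀ x : ZMod 2, x + x = 0 := by decide
  induction huv with
  | rel u v h =>
    refine ⟨hK _ _ h, fun hu => ?_⟩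
    have hv := (hK _ _ h).1 hu
    cases h with
    | @top x y h =>
      refine ⟨fun a => ind (Before x a) + ind (Before y a), fun _ => 0,
        ?_, fun _ _ _ _ => rfl, ?_, ?_, ?_⟩
      · intro a b hab ha
        exact chord_eq p h hab fun h' => ha ((hK _ _ (.top h')).1 hu)
      · intro m hm
        rcases x with x | x <;> rcases y with y | y <;> simp [Before, upper, midParity]
      · intro a
        rcases x with x | x <;> rcases y with y | y <;> simp [Before, upper, outerParity]
      · intro a
        rcases x with x | x <;> rcases y with y | y <;> simp [upper, outerParity, two]
    | @bot x y h =>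
      refine ⟨fun _ => 0, fun a => ind (Before x a) + ind (Before y a),
        fun _ _ _ _ => rfl, ?_, ?_, ?_, ?_⟩
      · intro a b hab ha
        exact chord_eq q h hab fun h' => ha ((hK _ _ (.bot h')).1 hu)
      · intro m hm
        have aux : ∀ b : B, K (.inr (.inl b)) →
            ind (b < m) = 1 + ind (m < b) := by
          intro b hb
          rcases lt_trichotomy b m with h | rfl | h
          · rw [ind_of h, ind_of_not h.not_gt, add_zero]
          · exact absurd hb hm
          · rw [ind_of_not h.not_gt, ind_of h, two]
        rcases x with x | x <;> rcases y with y | y <;> simp only [Before, midParity] <;>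
          (try rw [aux _ hu]) <;> (try rw [aux _ hv]) <;> simp <;> grind
      · intro a
        rcases x with x | x <;> rcases y with y | y <;> simp [outerParity]
      · intro a
        rcases x with x | x <;> rcases y with y | y <;> simp [Before, outerParity, two]
  | refl u =>
    refine ⟨Iff.rfl, fun _ => ⟨fun _ => 0, fun _ => 0, fun _ _ _ _ => rfl, fun _ _ _ _ => rfl,
      ?_, ?_, ?_⟩⟩ <;> intros <;> simp [dbl]
  | symm u v _ ih =>
    refine ⟨ih.1.symm, fun hv => ?_⟩
    obtain ⟨f, g, h1, h2, h3, h4, h5⟩ := ih.2 (ih.1.2 hv)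
    refine ⟨f, g, h1, h2, ?_, ?_, ?_⟩
    · intro m hm; rw [h3 m hm, add_comm]
    · intro a; rw [h4, add_comm]
    · intro a; rw [h5, add_comm]
  | trans u v w _ _ ih ih' =>
    refine ⟨ih.1.trans ih'.1, fun hu => ?_⟩
    obtain ⟨f, g, h1, h2, h3, h4, h5⟩ := ih.2 hu
    obtain ⟨f', g', h1', h2', h3', h4', h5'⟩ := ih'.2 (ih.1.1 hu)
    refine ⟨fun a => f a + f' a, fun a => g a + g' a, ?_, ?_, ?_, ?_, ?_⟩
    · intro a b h h'; simp only [h1 a b h h', h1' a b h h']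
    · intro a b h h'; simp only [h2 a b h h', h2' a b h h']
    · intro m hm
      linear_combination h3 m hm + h3' m hm + dbl (midParity v m)
    · intro a
      linear_combination h4 a + h4' a + dbl (outerParity v (.inl a))
    · intro a
      linear_combination h5 a + h5' a + dbl (outerParity v (.inr a))

/-- The composition `q ∘ p`: stack the diagram of `p` on top of the diagram of `q`, identify the
middle rows, and keep what is connected to the outer rows. -/
def comp (p : NCPart A B) (q : NCPart B C) : NCPart A C where
  rel := Setoid.comap outer (stack p.rel q.rel)
  noncrossing := by
    intro w x y z h1 h2 h3 h h'
    by_contra hwx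
    change stack p.rel q.rel (outer w) (outer y) at h
    change stack p.rel q.rel (outer x) (outer z) at h'
    change ¬ stack p.rel q.rel (outer w) (outer x) at hwx
    let K : A ⊕ B ⊕ C → Prop := fun v => stack p.rel q.rel (outer w) v
    have hK : ∀ u v, Linked p.rel q.rel u v → (K u ↔ K v) := fun u v huv =>
      ⟨fun hu => hu.trans _ _ _ (.rel _ _ huv), fun hv => hv.trans _ _ _ (.symm _ _ (.rel _ _ huv))⟩
    obtain ⟨f, g, hf, hg, hm, hA, hC⟩ := (exists_potential p q K hK h).2 (.refl _)
    have two : (1 + 1 : ZMod 2) = 0 := rfl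
    have hmid : ∀ m : B, ¬ K (.inr (.inl m)) → f (.inr m) = g (.inl m) := by
      intro m hm'
      have := hm m hm'
      have e : midParity (outer w) m + midParity (outer y) m = 0 := by
        rcases w with w | w <;> rcases y with y | y <;> exact two
      rw [e] at this
      have aux : ∀ a b : ZMod 2, a + b = 0 → a = b := by decide
      exact aux _ _ this
    let F : A ⊕ B ⊕ C → ZMod 2 := Sum.elim (fun a => f (.inl a)) g
    have hF : ∀ u v, stack p.rel q.rel u v → ¬ K u → F u = F v := by
      intro u v huv
      induction huv with
      | rel u v h =>
        intro hu
        have hv := (hK _ _ h).not.1 hu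
        cases h with
        | @top a b h =>
          have e : ∀ a : A ⊕ B, ¬ K (upper a) → F (upper a) = f a := by
            rintro (a | a) ha
            · rfl
            · exact (hmid a ha).symm
          rw [e _ hu, e _ hv]
          exact hf _ _ h hu
        | bot h => exact hg _ _ h hu
      | refl u => exact fun _ => rfl
      | symm u v huv ih =>
        intro hv
        exact (ih fun hu => hv (Relation.EqvGen.trans _ _ _ hu huv)).symm
      | trans u v w huv _ ih ih' =>
        intro hu
        exact (ih hu).trans
          (ih' fun hv => hu (Relation.EqvGen.trans _ _ _ hv (.symm _ _ huv)))
    have hval : ∀ v : A ⊕ C, F (outer v) =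
        outerParity (outer w : A ⊕ B ⊕ C) v + outerParity (outer y : A ⊕ B ⊕ C) v := by
      rintro (v | v)
      · exact hA v
      · exact hC v
    have hpar : ∀ u v : A ⊕ C, outerParity (outer u : A ⊕ B ⊕ C) v = ind (Before u v) := by
      rintro (u | u) (v | v) <;> simp [outerParity, outer, Before]
    have := hF _ _ h' hwx
    rw [hval, hval, hpar, hpar, hpar, hpar, ind_of h1, ind_of_not h2.asymm,
      ind_of (h1.trans (h2.trans h3)), ind_of h3] at this
    exact absurd this (by decide)

theorem id_comp (p : NCPart A B) : comp id p = p := by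
  ext x y
  constructor
  · intro h
    have key : ∀ u v : A ⊕ A ⊕ B, stack (id : NCPart A A).rel p.rel u v →
        p.rel (Sum.elim .inl _root_.id u) (Sum.elim .inl _root_.id v) := by
      intro u v h
      induction h with
      | rel u v h =>
        cases h with
        | @top x y h =>
          have h : Sum.elim _root_.id _root_.id x = Sum.elim _root_.id _root_.id y := h
          rcases x with x | x <;> rcases y with y | y <;> cases h <;> exact p.rel.refl _
        | bot h => exact h
      | refl u => exact p.rel.refl _
      | symm _ _ _ ih => exact p.rel.symm ih
      | trans _ _ _ _ _ ih ih' => exact p.rel.trans ih ih'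
    have := key _ _ h
    rcases x with x | x <;> rcases y with y | y <;> exact this
  · intro h
    have key : ∀ x : A ⊕ B, stack (id : NCPart A A).rel p.rel (outer x) (.inr x) := by
      rintro (x | x)
      · exact .rel _ _ (@Linked.top A A B _ _ (.inl x) (.inr x) rfl)
      · exact .refl _
    exact .trans _ _ _ (key x) (.trans _ _ _ (.rel _ _ (.bot h)) (.symm _ _ (key y)))

theorem comp_id (p : NCPart A B) : comp p id = p := by
  ext x y
  constructor
  · intro h
    have key : ∀ u v : A ⊕ B ⊕ B, stack p.rel (id : NCPart B B).rel u v →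
        p.rel (Sum.map _root_.id (Sum.elim _root_.id _root_.id) u)
          (Sum.map _root_.id (Sum.elim _root_.id _root_.id) v) := by
      intro u v h
      induction h with
      | rel u v h =>
        cases h with
        | @top x y h => rcases x with x | x <;> rcases y with y | y <;> exact h
        | @bot x y h =>
          have h : Sum.elim _root_.id _root_.id x = Sum.elim _root_.id _root_.id y := h
          rcases x with x | x <;> rcases y with y | y <;> cases h <;> exact p.rel.refl _
      | refl u => exact p.rel.refl _
      | symm _ _ _ ih => exact p.rel.symm ih
      | trans _ _ _ _ _ ih ih' => exact p.rel.trans ih ih'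
    have := key _ _ h
    rcases x with x | x <;> rcases y with y | y <;> exact this
  · intro h
    have key : ∀ x : A ⊕ B, stack p.rel (id : NCPart B B).rel (outer x) (upper x) := by
      rintro (x | x)
      · exact .refl _
      · exact .rel _ _ (@Linked.bot A B B _ _ (.inr x) (.inl x) rfl)
    exact .trans _ _ _ (key x) (.trans _ _ _ (.rel _ _ (.top h)) (.symm _ _ (key y)))

theorem eqvGen_restrict {V X : Type} (e : X → V) (L M : V → V → Prop) (S T : X → X → Prop)
    (hT : ∀ a b, Relation.EqvGen L (e a) (e b) → Relation.EqvGen T a b) (hS : ∀ a b, S a b → T a b)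
    (hM : ∀ u v, M u v → L u v ∨ ∃ a b, S a b ∧ u = e a ∧ v = e b) {x y : X}
    (h : Relation.EqvGen M (e x) (e y)) : Relation.EqvGen T x y := by
  have key : ∀ u v, Relation.EqvGen M u v →
      ((∃ w, Relation.EqvGen T x w ∧ Relation.EqvGen L (e w) u) ↔
        ∃ w, Relation.EqvGen T x w ∧ Relation.EqvGen L (e w) v) := by
    intro u v huv
    induction huv with
    | rel u v huv =>
      rcases hM _ _ huv with h | ⟨a, b, hab, rfl, rfl⟩
      · constructor
        · rintro ⟨w, hw, h'⟩
          exact ⟨w, hw, h'.trans _ _ _ (.rel _ _ h)⟩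
        · rintro ⟨w, hw, h'⟩
          exact ⟨w, hw, h'.trans _ _ _ (.symm _ _ (.rel _ _ h))⟩
      · constructor
        · rintro ⟨w, hw, h'⟩
          exact ⟨b, hw.trans _ _ _ ((hT _ _ h').trans _ _ _ (.rel _ _ (hS _ _ hab))), .refl _⟩
        · rintro ⟨w, hw, h'⟩
          exact ⟨a, hw.trans _ _ _
            ((hT _ _ h').trans _ _ _ (.symm _ _ (.rel _ _ (hS _ _ hab)))), .refl _⟩
    | refl u => exact Iff.rfl
    | symm _ _ _ ih => exact ih.symm
    | trans _ _ _ _ _ ih ih' => exact ih.trans ih'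
  obtain ⟨w, hw, h'⟩ := (key _ _ h).1 ⟨x, .refl _, .refl _⟩
  exact hw.trans _ _ _ (hT _ _ h')

theorem eqvGen_emb {V Y : Type} (i : Y → V) (hi : Function.Injective i) (L : Y → Y → Prop) {u v : V}
    (h : Relation.EqvGen (fun u v => ∃ a b, L a b ∧ u = i a ∧ v = i b) u v) :
    u = v ∨ ∃ a b, Relation.EqvGen L a b ∧ u = i a ∧ v = i b := by
  induction h with
  | rel u v h =>
    obtain ⟨a, b, h, e, e'⟩ := h
    exact .inr ⟨a, b, .rel _ _ h, e, e'⟩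
  | refl u => exact .inl rfl
  | symm u v _ ih =>
    rcases ih with rfl | ⟨a, b, h, e, e'⟩
    · exact .inl rfl
    · exact .inr ⟨b, a, .symm _ _ h, e', e⟩
  | trans u v w _ _ ih ih' =>
    rcases ih with rfl | ⟨a, b, h, e, e'⟩
    · exact ih'
    · rcases ih' with rfl | ⟨c, d, h', f, f'⟩
      · exact .inr ⟨a, b, h, e, e'⟩
      · obtain rfl := hi (e'.symm.trans f)
        exact .inr ⟨a, d, .trans _ _ _ h h', e, f'⟩

theorem eqvGen_map {V Y : Type} (i : Y → V) {L : Y → Y → Prop} {M : V → V → Prop}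
    (h : ∀ a b, L a b → Relation.EqvGen M (i a) (i b)) {a b : Y} (hab : Relation.EqvGen L a b) :
    Relation.EqvGen M (i a) (i b) := by
  induction hab with
  | rel _ _ h' => exact h _ _ h'
  | refl => exact .refl _
  | symm _ _ _ ih => exact .symm _ _ ih
  | trans _ _ _ _ _ ih ih' => exact .trans _ _ _ ih ih'

/-- Two points of a stack of three diagrams are linked if they lie in a common block of one of them. -/
inductive Linked₃ (p : Setoid (A ⊕ B)) (q : Setoid (B ⊕ C)) (r : Setoid (C ⊕ D)) :
    A ⊕ B ⊕ C ⊕ D → A ⊕ B ⊕ C ⊕ D → Prop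
  | top {x y : A ⊕ B} (h : p x y) : Linked₃ p q r (Sum.map _root_.id .inl x) (Sum.map _root_.id .inl y)
  | mid {x y : B ⊕ C} (h : q x y) :
      Linked₃ p q r (.inr (Sum.map _root_.id .inl x)) (.inr (Sum.map _root_.id .inl y))
  | bot {x y : C ⊕ D} (h : r x y) : Linked₃ p q r (.inr (.inr x)) (.inr (.inr y))

theorem assoc_left (p : NCPart A B) (q : NCPart B C) (r : NCPart C D) (x y : A ⊕ D) :
    (comp (comp p q) r).rel x y ↔ Relation.EqvGen (Linked₃ p.rel q.rel r.rel)
      (Sum.map _root_.id (fun d => .inr (.inr d)) x) (Sum.map _root_.id (fun d => .inr (.inr d)) y) := by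
  let e : A ⊕ C ⊕ D → A ⊕ B ⊕ C ⊕ D := Sum.map _root_.id .inr
  let i : A ⊕ B ⊕ C → A ⊕ B ⊕ C ⊕ D := Sum.map _root_.id (Sum.map _root_.id .inl)
  have hi : Function.Injective i :=
    Function.injective_id.sumMap (Function.injective_id.sumMap Sum.inl_injective)
  have he : ∀ x : A ⊕ D, e (outer x) = Sum.map _root_.id (fun d => .inr (.inr d)) x := by
    rintro (x | x) <;> rfl
  have hie : ∀ x : A ⊕ C, e (upper x) = i (outer x) := by
    rintro (x | x) <;> rfl
  have hi' : ∀ a b, Linked p.rel q.rel a b → Linked₃ p.rel q.rel r.rel (i a) (i b) := by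
    rintro _ _ (⟨h⟩ | ⟨h⟩)
    · have := Linked₃.top (q := q.rel) (r := r.rel) h
      rename_i x y
      rcases x with x | x <;> rcases y with y | y <;> exact this
    · exact Linked₃.mid h
  rw [← he, ← he]
  constructor
  · refine eqvGen_map e ?_
    rintro _ _ (⟨h⟩ | ⟨h⟩)
    · rw [hie, hie]
      exact eqvGen_map i (fun a b h => .rel _ _ (hi' a b h)) h
    · exact .rel _ _ (.bot h)
  · refine eqvGen_restrict e (fun u v => ∃ a b, Linked p.rel q.rel a b ∧ u = i a ∧ v = i b) _
      (fun u v => ∃ a b, r.rel a b ∧ u = .inr a ∧ v = .inr b) _ ?_ ?_ ?_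
    · intro a b h
      rcases eqvGen_emb i hi _ h with h | ⟨a', b', h, ha, hb⟩
      · have : a = b := Function.injective_id.sumMap Sum.inr_injective h
        exact this ▸ .refl _
      · have aux : ∀ (a : A ⊕ C ⊕ D) a', e a = i a' → ∃ x, a = upper x ∧ a' = outer x := by
          rintro (a | a | a) (a' | a' | a') h <;> simp [e, i] at h
          · exact ⟨.inl a, rfl, by rw [h]; rfl⟩
          · exact ⟨.inr a, rfl, by rw [h]; rfl⟩
        obtain ⟨x, rfl, rfl⟩ := aux _ _ ha
        obtain ⟨y, rfl, rfl⟩ := aux _ _ hb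
        exact .rel _ _ (.top h)
    · rintro _ _ ⟨a, b, h, rfl, rfl⟩
      exact .bot h
    · rintro _ _ (⟨h⟩ | ⟨h⟩ | ⟨h⟩)
      · rename_i x y
        refine .inl ⟨upper x, upper y, .top h, ?_, ?_⟩
        · rcases x with x | x <;> rfl
        · rcases y with y | y <;> rfl
      · rename_i x y
        exact .inl ⟨.inr x, .inr y, .bot h, rfl, rfl⟩
      · exact .inr ⟨_, _, ⟨_, _, h, rfl, rfl⟩, rfl, rfl⟩

theorem assoc_right (p : NCPart A B) (q : NCPart B C) (r : NCPart C D) (x y : A ⊕ D) :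
    (comp p (comp q r)).rel x y ↔ Relation.EqvGen (Linked₃ p.rel q.rel r.rel)
      (Sum.map _root_.id (fun d => .inr (.inr d)) x) (Sum.map _root_.id (fun d => .inr (.inr d)) y) := by
  let e : A ⊕ B ⊕ D → A ⊕ B ⊕ C ⊕ D := Sum.map _root_.id (Sum.map _root_.id .inr)
  let i : B ⊕ C ⊕ D → A ⊕ B ⊕ C ⊕ D := .inr
  have hi : Function.Injective i := Sum.inr_injective
  have he : ∀ x : A ⊕ D, e (outer x) = Sum.map _root_.id (fun d => .inr (.inr d)) x := by
    rintro (x | x) <;> rfl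
  have hie : ∀ x : B ⊕ D, e (.inr x) = i (outer x) := by
    rintro (x | x) <;> rfl
  have hi' : ∀ a b, Linked q.rel r.rel a b → Linked₃ p.rel q.rel r.rel (i a) (i b) := by
    rintro _ _ (⟨h⟩ | ⟨h⟩)
    · exact Linked₃.mid h
    · exact Linked₃.bot h
  have heu : ∀ x : A ⊕ B, e (upper x) = Sum.map _root_.id .inl x := by
    rintro (x | x) <;> rfl
  rw [← he, ← he]
  constructor
  · refine eqvGen_map e ?_
    rintro _ _ (⟨h⟩ | ⟨h⟩)
    · rw [heu, heu]
      exact .rel _ _ (.top h)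
    · rw [hie, hie]
      exact eqvGen_map i (fun a b h => .rel _ _ (hi' a b h)) h
  · refine eqvGen_restrict e (fun u v => ∃ a b, Linked q.rel r.rel a b ∧ u = i a ∧ v = i b) _
      (fun u v => ∃ a b, p.rel a b ∧ u = upper a ∧ v = upper b) _ ?_ ?_ ?_
    · intro a b h
      rcases eqvGen_emb i hi _ h with h | ⟨a', b', h, ha, hb⟩
      · have : a = b :=
          Function.injective_id.sumMap (Function.injective_id.sumMap Sum.inr_injective) h
        exact this ▸ .refl _
      · have aux : ∀ (a : A ⊕ B ⊕ D) a', e a = i a' → ∃ x, a = .inr x ∧ a' = outer x := by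
          rintro (a | a | a) (a' | a' | a') h <;> simp [e, i] at h
          · exact ⟨.inl a, rfl, by rw [h]; rfl⟩
          · exact ⟨.inr a, rfl, by rw [h]; rfl⟩
        obtain ⟨x, rfl, rfl⟩ := aux _ _ ha
        obtain ⟨y, rfl, rfl⟩ := aux _ _ hb
        exact .rel _ _ (.bot h)
    · rintro _ _ ⟨a, b, h, rfl, rfl⟩
      exact .top h
    · rintro _ _ (⟨h⟩ | ⟨h⟩ | ⟨h⟩)
      · exact .inr ⟨_, _, ⟨_, _, h, rfl, rfl⟩, (heu _).symm, (heu _).symm⟩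
      · exact .inl ⟨_, _, .top h, rfl, rfl⟩
      · exact .inl ⟨_, _, .bot h, rfl, rfl⟩

theorem comp_assoc (p : NCPart A B) (q : NCPart B C) (r : NCPart C D) :
    comp (comp p q) r = comp p (comp q r) := by
  ext x y
  exact (assoc_left p q r x y).trans (assoc_right p q r x y).symm

end NCPart
end NC

/-! ### Objects -/

/-- The objects of `C_k`. An object of `C_{k+1}` is a finite sequence `(m; α_1, …, α_m)` of objects of
`C_k`, drawn as a row of `m` ellipses containing `α_1, …, α_m`. The auxiliary `C_0` has a single
object, so that an object of `C_1` is given by the number `m` of its points. -/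
def Obj : ℕ → Type
  | 0 => Unit
  | k + 1 => List (Obj k)

namespace Obj

/-- The object `(m; α_1, …, α_m)`. -/
def mk {k : ℕ} (l : List (Obj k)) : Obj (k + 1) := l

/-- The sequence `α_1, …, α_m` of an object `(m; α_1, …, α_m)`. -/
def tubes {k : ℕ} (γ : Obj (k + 1)) : List (Obj k) := γ

/-- The number `m` of outermost ellipses (or points) of an object. -/
def width : {k : ℕ} → Obj k → ℕ
  | 0, _ => 0
  | _ + 1, γ => γ.tubes.length

/-- The tensor product of objects: juxtaposition. -/
def tensor : {k : ℕ} → Obj k → Obj k → Obj k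
  | 0, _, _ => ()
  | _ + 1, γ, δ => mk (γ.tubes ++ δ.tubes)

/-- The unit object. -/
def unit : {k : ℕ} → Obj k
  | 0 => ()
  | _ + 1 => mk []

/-- The tensor product `α_1 ⊗ … ⊗ α_m`. -/
def tensorList {k : ℕ} : List (Obj k) → Obj k
  | [] => unit
  | [α] => α
  | α :: β :: l => tensor α (tensorList (β :: l))

/-- The ellipses and points of an object are addressed by paths: `[i]` is the `i`-th outermost ellipse
(counted from `0`), and `i :: t` is the ellipse or point with address `t` inside it. -/
def IsNode : {k : ℕ} → Obj k → List ℕ → Prop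
  | 0, _, _ => False
  | _ + 1, _, [] => False
  | _ + 1, γ, i :: t => ∃ α, γ.tubes[i]? = some α ∧ (t = [] ∨ IsNode α t)

theorem isNode_cons {k : ℕ} {γ : Obj (k + 1)} {i : ℕ} {t : List ℕ} :
    IsNode γ (i :: t) ↔ ∃ α, γ.tubes[i]? = some α ∧ (t = [] ∨ IsNode α t) := Iff.rfl

theorem IsNode.dropLast : {k : ℕ} → {γ : Obj k} → {x : List ℕ} → IsNode γ x → x.dropLast ≠ [] →
    IsNode γ x.dropLast
  | 0, _, _, h, _ => h.elim
  | _ + 1, _, [], h, _ => h.elim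
  | _ + 1, _, [_], _, h' => absurd rfl h'
  | _ + 1, _, i :: c :: t, ⟨α, hα, h⟩, _ => by
    rcases h with h | h
    · cases h
    refine ⟨α, hα, ?_⟩
    by_cases h' : (c :: t).dropLast = []
    · exact .inl h'
    · exact .inr (h.dropLast h')

theorem IsNode.lt_width : {k : ℕ} → {γ : Obj k} → {i : ℕ} → {t : List ℕ} → IsNode γ (i :: t) →
    i < γ.width
  | 0, _, _, _, h => h.elim
  | _ + 1, _, _, _, ⟨_, hα, _⟩ => (List.getElem?_eq_some_iff.1 hα).1

theorem isNode_tensor_left : {k : ℕ} → {γ δ : Obj k} → {i : ℕ} → {t : List ℕ} → i < γ.width →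
    (IsNode (tensor γ δ) (i :: t) ↔ IsNode γ (i :: t))
  | 0, _, _, _, _, h => absurd h (Nat.not_lt_zero _)
  | _ + 1, γ, δ, i, t, h => by
    rw [isNode_cons, isNode_cons]
    have : (tensor γ δ).tubes[i]? = γ.tubes[i]? := List.getElem?_append_left h
    rw [this]

theorem isNode_tensor_right : {k : ℕ} → {γ δ : Obj k} → {i : ℕ} → {t : List ℕ} →
    (IsNode (tensor γ δ) ((γ.width + i) :: t) ↔ IsNode δ (i :: t))
  | 0, _, _, _, _ => Iff.rfl
  | _ + 1, γ, δ, i, t => by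
    rw [isNode_cons, isNode_cons]
    have : (tensor γ δ).tubes[γ.width + i]? = δ.tubes[i]? := by
      refine (List.getElem?_append_right (Nat.le_add_right γ.tubes.length i)).trans ?_
      rw [Nat.add_sub_cancel_left]
    rw [this]

end Obj

open Obj

/-- The ellipses or points of `γ` at nesting depth `j` (the outermost ones have depth `0`), ordered
from left to right, which is the lexicographic order of their paths. -/
abbrev Node {k : ℕ} (γ : Obj k) (j : ℕ) : Type := {x : List ℕ // x.length = j + 1 ∧ IsNode γ x}

/-- The smallest ellipse around a node. -/
def parent {k : ℕ} {γ : Obj k} {j : ℕ} (x : Node γ (j + 1)) : Node γ j :=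
  ⟨x.1.dropLast, by simp [x.2.1],
    x.2.2.dropLast (List.ne_nil_of_length_pos (by simp [x.2.1]))⟩

theorem Node.exists_cons {k : ℕ} {γ : Obj k} {j : ℕ} (x : Node γ j) :
    ∃ i t, x.1 = i :: t ∧ t.length = j := by
  obtain ⟨x, hx, h⟩ := x
  cases x with
  | nil => simp at hx
  | cons i t => exact ⟨i, t, rfl, by simpa using hx⟩

/-- Decides whether a node of `γ ⊗ δ` belongs to `γ` or to `δ`. -/
def split {k : ℕ} {γ δ : Obj k} {j : ℕ} (x : Node (tensor γ δ) j) : Node γ j ⊕ₗ Node δ j :=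
  if h : x.1.headI < γ.width then
    toLex (.inl ⟨x.1, x.2.1, by
      obtain ⟨i, t, hx, -⟩ := x.exists_cons
      have h' := x.2.2
      rw [hx] at h h' ⊢
      exact (isNode_tensor_left h).1 h'⟩)
  else
    toLex (.inr ⟨(x.1.headI - γ.width) :: x.1.tail, by
      obtain ⟨i, t, hx, ht⟩ := x.exists_cons
      have h' := x.2.2
      rw [hx] at h h' ⊢
      refine ⟨by simpa using ht, (isNode_tensor_right (γ := γ)).1 ?_⟩
      change IsNode (tensor γ δ) ((γ.width + (i - γ.width)) :: t)
      have h : ¬ i < γ.width := h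
      rwa [Nat.add_sub_cancel' (not_lt.1 h)]⟩)

theorem split_strictMono {k : ℕ} {γ δ : Obj k} {j : ℕ} :
    StrictMono (split : Node (tensor γ δ) j → Node γ j ⊕ₗ Node δ j) := by
  intro x y h
  obtain ⟨i, s, hx, -⟩ := x.exists_cons
  obtain ⟨i', s', hy, -⟩ := y.exists_cons
  have h : x.1 < y.1 := h
  have h0 := h
  rw [hx, hy, List.cons_lt_cons_iff] at h
  have hle : i ≤ i' := by rcases h with h | ⟨h, -⟩ <;> omega
  unfold split
  split_ifs with h1 h2 h2
  · exact Sum.Lex.inl_lt_inl_iff.2 h0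
  · exact Sum.Lex.inl_lt_inr _ _
  · rw [hx] at h1; rw [hy] at h2
    exact absurd (lt_of_le_of_lt hle h2) h1
  · refine Sum.Lex.inr_lt_inr_iff.2 ?_
    change (x.1.headI - γ.width) :: x.1.tail < (y.1.headI - γ.width) :: y.1.tail
    rw [hx] at h1 ⊢; rw [hy] at h2 ⊢
    simp only [List.headI, List.tail] at h1 h2 ⊢
    rw [List.cons_lt_cons_iff]
    rcases h with h | ⟨h, h'⟩
    · left; omega
    · right; exact ⟨by omega, h'⟩

theorem split_parent {k : ℕ} {γ δ : Obj k} {j : ℕ} (x : Node (tensor γ δ) (j + 1)) :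
    split (parent x) = toLex ((ofLex (split x)).map parent parent) := by
  obtain ⟨x, hx, hn⟩ := x
  match x, hx, hn with
  | i :: c :: t, hx, hn =>
    by_cases h : i < γ.width
    · simp [split, parent, h]
    · simp [split, parent, h]

/-! ### Morphisms -/

/-- A morphism of `C_k` is a nesting of `k` levels of non-crossing partitions, each level contained in
the one above: for every depth `j` a non-crossing partition of the upper and lower nodes of depth `j`,
such that the tubes around two nodes of one block lie in one block. In the notation
`(p; φ_1, …, φ_l)` for `C_{k+1}`, the partition of depth `0` is `p = {B_1, …, B_l}`, and the part of
the deeper levels inside the tubes of the block `B_i` is `φ_i`, a morphism of `C_k` from the tensor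
product of the contents of the upper ellipses of `B_i` to that of the lower ones. -/
@[ext]
structure Hom {k : ℕ} (γ δ : Obj k) where
  level : ∀ j : ℕ, NCPart (Node γ j) (Node δ j)
  nested : ∀ (j : ℕ) (x y : Node γ (j + 1) ⊕ Node δ (j + 1)), (level (j + 1)).rel x y →
    (level j).rel (x.map parent parent) (y.map parent parent)

namespace Hom

variable {k : ℕ}

/-- The identity morphism. -/
def id (γ : Obj k) : Hom γ γ where
  level _ := NCPart.id
  nested j x y h := by
    have h : Sum.elim _root_.id _root_.id x = Sum.elim _root_.id _root_.id y := h
    change Sum.elim _root_.id _root_.id _ = Sum.elim _root_.id _root_.id _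
    rcases x with x | x <;> rcases y with y | y <;> cases h <;> rfl

/-- Composition: the diagrams are stacked vertically, the middle objects are identified, and every
block without connection to the upper or lower openings is deleted. -/
def comp {γ δ ε : Obj k} (f : Hom γ δ) (g : Hom δ ε) : Hom γ ε where
  level j := NCPart.comp (f.level j) (g.level j)
  nested j x y h := by
    have key : ∀ u v, NCPart.stack (f.level (j + 1)).rel (g.level (j + 1)).rel u v →
        NCPart.stack (f.level j).rel (g.level j).rel (u.map parent (Sum.map parent parent))
          (v.map parent (Sum.map parent parent)) := by
      intro u v h
      refine NCPart.eqvGen_map (Sum.map parent (Sum.map parent parent)) ?_ h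
      rintro _ _ (⟨h⟩ | ⟨h⟩)
      · have := NCPart.Linked.top (q := (g.level j).rel) (f.nested j _ _ h)
        rename_i x y
        rcases x with x | x <;> rcases y with y | y <;> exact .rel _ _ this
      · exact .rel _ _ (.bot (g.nested j _ _ h))
    have := key _ _ h
    rcases x with x | x <;> rcases y with y | y <;> exact this

/-- The adjoint: vertical reflection. -/
def adj {γ δ : Obj k} (f : Hom γ δ) : Hom δ γ where
  level j := (f.level j).adj
  nested j x y h := by
    have := f.nested j _ _ h
    rcases x with x | x <;> rcases y with y | y <;> exact this

/-- The tensor product: horizontal juxtaposition. -/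
def tensor {γ δ γ' δ' : Obj k} (f : Hom γ δ) (g : Hom γ' δ') :
    Hom (Obj.tensor γ γ') (Obj.tensor δ δ') where
  level j := ((f.level j).tensor (g.level j)).comap split split split_strictMono split_strictMono
  nested j x y h := by
    have e : ∀ x : Node (Obj.tensor γ γ') (j + 1) ⊕ Node (Obj.tensor δ δ') (j + 1),
        NCPart.regroup ((x.map parent parent).map split split) =
          (NCPart.regroup (x.map split split)).map (Sum.map parent parent)
            (Sum.map parent parent) := by
      rintro (x | x) <;> simp only [Sum.map_inl, Sum.map_inr, NCPart.regroup, Sum.elim_inl,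
        Sum.elim_inr, split_parent] <;> rcases (split x) with x | x <;> rfl
    change Sum.LiftRel (f.level (j + 1)).rel (g.level (j + 1)).rel
      (NCPart.regroup (x.map split split)) (NCPart.regroup (y.map split split)) at h
    change Sum.LiftRel (f.level j).rel (g.level j).rel
      (NCPart.regroup ((x.map parent parent).map split split))
      (NCPart.regroup ((y.map parent parent).map split split))
    rw [e, e]
    rcases hx : NCPart.regroup (x.map split split) with x' | x' <;>
      rcases hy : NCPart.regroup (y.map split split) with y' | y' <;> rw [hx, hy] at h <;>
      rcases h with ⟨h⟩ | ⟨h⟩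
    · exact .inl (f.nested j _ _ h)
    · exact .inr (g.nested j _ _ h)

end Hom

instance (k : ℕ) : Category (Obj k) where
  Hom := Hom
  id := Hom.id
  comp := Hom.comp
  id_comp f := Hom.ext (funext fun j => NCPart.id_comp (f.level j))
  comp_id f := Hom.ext (funext fun j => NCPart.comp_id (f.level j))
  assoc f g h := Hom.ext (funext fun j => NCPart.comp_assoc (f.level j) (g.level j) (h.level j))

/-- The tensor product of morphisms, as a morphism of the category `C_k`. -/
def tensorHom {k : ℕ} {γ δ γ' δ' : Obj k} (f : γ ⟶ δ) (g : γ' ⟶ δ') :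
    tensor γ γ' ⟶ tensor δ δ' := Hom.tensor f g

/-- The adjoint of a morphism, as a morphism of the category `C_k`. -/
def adjoint {k : ℕ} {γ δ : Obj k} (f : γ ⟶ δ) : δ ⟶ γ := Hom.adj f

/-- The position of the contents of the `i`-th ellipse in the tensor product of all contents. -/
def offset {k : ℕ} (l : List (Obj k)) (i : ℕ) : ℕ := ((l.take i).map width).sum

theorem isNode_tensorList {k : ℕ} : ∀ (l : List (Obj k)) (i c : ℕ) (t : List ℕ) (α : Obj k),
    l[i]? = some α → IsNode α (c :: t) → IsNode (tensorList l) ((offset l i + c) :: t)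
  | [], i, c, t, α, h, _ => by simp at h
  | [β], 0, c, t, α, h, h' => by
    obtain rfl : β = α := by simpa using h
    simpa [offset, tensorList] using h'
  | [β], i + 1, c, t, α, h, _ => by simp at h
  | β :: β' :: l, 0, c, t, α, h, h' => by
    obtain rfl : β = α := by simpa using h
    simpa [offset, tensorList] using (isNode_tensor_left h'.lt_width).2 h'
  | β :: β' :: l, i + 1, c, t, α, h, h' => by
    have := isNode_tensorList (β' :: l) i c t α (by simpa using h) h'
    have e : offset (β :: β' :: l) (i + 1) = width β + offset (β' :: l) i := by simp [offset]
    rw [e, add_assoc]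
    exact isNode_tensor_right.2 this

theorem offset_lt {k : ℕ} : ∀ (l : List (Obj k)) (i i' : ℕ) (α : Obj k), l[i]? = some α → i < i' →
    offset l i + width α ≤ offset l i'
  | [], _, _, _, h, _ => by simp at h
  | β :: l, _, 0, _, _, h' => by omega
  | β :: l, 0, i' + 1, α, h, _ => by
    obtain rfl : β = α := by simpa using h
    simp [offset]
  | β :: l, i + 1, i' + 1, α, h, h' => by
    have := offset_lt l i i' α (by simpa using h) (by omega)
    simp only [offset, List.take_succ_cons, List.map_cons, List.sum_cons] at this ⊢
    omega

/-- The path, in the tensor product of all contents, of the node with a given path inside a tube. -/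
def contentPath {k : ℕ} (l : List (Obj k)) : List ℕ → List ℕ
  | i :: c :: t => (offset l i + c) :: t
  | x => x

/-- The nodes of `(m; α_1, …, α_m)` inside the outermost ellipses, as nodes of `α_1 ⊗ … ⊗ α_m`. -/
def content {k : ℕ} {γ : Obj (k + 1)} {j : ℕ} (x : Node γ (j + 1)) :
    Node (tensorList γ.tubes) j :=
  ⟨contentPath γ.tubes x.1, by
    obtain ⟨x, hx, h⟩ := x
    match x, hx, h with
    | i :: c :: t, hx, ⟨α, hα, h⟩ =>
      exact ⟨by simpa [contentPath] using hx,
        isNode_tensorList _ _ _ _ _ hα (h.resolve_left (List.cons_ne_nil _ _))⟩⟩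

theorem content_strictMono {k : ℕ} {γ : Obj (k + 1)} {j : ℕ} :
    StrictMono (content : Node γ (j + 1) → Node (tensorList γ.tubes) j) := by
  rintro ⟨x, hx, h⟩ ⟨y, hy, h'⟩ hxy
  match x, hx, h, y, hy, h', hxy with
  | i :: c :: t, hx, ⟨α, hα, h⟩, i' :: c' :: t', hy, h', hxy =>
    have hc := (h.resolve_left (List.cons_ne_nil _ _)).lt_width
    change i :: c :: t < i' :: c' :: t' at hxy
    change (offset γ.tubes i + c) :: t < (offset γ.tubes i' + c') :: t'
    rw [List.cons_lt_cons_iff] at hxy ⊢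
    rcases hxy with hi | ⟨rfl, hxy⟩
    · left
      have := offset_lt γ.tubes i i' α hα hi
      omega
    · rw [List.cons_lt_cons_iff] at hxy
      rcases hxy with hi | ⟨rfl, hxy⟩
      · left; omega
      · right; exact ⟨rfl, hxy⟩

theorem content_parent {k : ℕ} {γ : Obj (k + 1)} {j : ℕ} (x : Node γ (j + 2)) :
    content (parent x) = parent (content x) := by
  obtain ⟨x, hx, hn⟩ := x
  match x, hx, hn with
  | i :: c :: d :: t, hx, hn => simp [content, parent, contentPath]

/-! ### Generators -/

variable {k : ℕ}

/-- The morphism `(p; φ)` from `(m; α_1, …, α_m)` to `(n; β_1, …, β_n)`, where `p` has a single block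
and `φ : α_1 ⊗ … ⊗ α_m ⟶ β_1 ⊗ … ⊗ β_n`. -/
def singleBlock {γ δ : Obj (k + 1)} (φ : tensorList γ.tubes ⟶ tensorList δ.tubes) : γ ⟶ δ :=
  { level := fun j => match j with
      | 0 => NCPart.oneBlock
      | j + 1 => (Hom.level φ j).comap content content content_strictMono content_strictMono
    nested := fun j x y h => match j, x, y, h with
      | 0, _, _, _ => trivial
      | j + 1, x, y, h => by
        have e : ∀ x : Node γ (j + 2) ⊕ Node δ (j + 2), (x.map parent parent).map content content =
            (x.map content content).map parent parent := by
          rintro (x | x) <;> simp only [Sum.map_inl, Sum.map_inr, content_parent]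
        change (Hom.level φ j).rel ((x.map parent parent).map content content)
          ((y.map parent parent).map content content)
        rw [e, e]
        exact Hom.nested φ j _ _ h }

/-- `Ψ(α) = (1; α)`. -/
def Psi (α : Obj k) : Obj (k + 1) := mk [α]

/-- `Ψ(φ) = (|; φ)`, the morphism `φ` put inside a tube. -/
def PsiMap {α β : Obj k} (φ : α ⟶ β) : Psi α ⟶ Psi β :=
  singleBlock (γ := Psi α) (δ := Psi β) φ

/-- The splitting morphism `P_{α,β}`, given by the one-block partition on one upper and two lower
points and the identity of `α ⊗ β`. -/
def splitting (α β : Obj k) : Psi (tensor α β) ⟶ tensor (Psi α) (Psi β) :=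
  singleBlock (γ := Psi (tensor α β)) (δ := tensor (Psi α) (Psi β)) (𝟙 (tensor α β))

/-- The cap: the one-block partition on no upper and one lower point, as a morphism of `C_{k+1}`. -/
def cap (k : ℕ) : (unit : Obj (k + 1)) ⟶ Psi unit :=
  singleBlock (γ := unit) (δ := Psi unit) (𝟙 (unit : Obj k))

/-- The generators of `C_{k+1}`. -/
inductive IsGenerator (k : ℕ) : MorphismProperty (Obj (k + 1))
  | tubed {α β : Obj k} (φ : α ⟶ β) : IsGenerator k (PsiMap φ)
  | splitting (α β : Obj k) : IsGenerator k (splitting α β)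
  | cap : IsGenerator k (cap k)

/-- The class of morphisms generated by `S`: the smallest one that contains `S` and is closed under
composition, tensor products and adjoints. -/
inductive Generated (S : MorphismProperty (Obj k)) : MorphismProperty (Obj k)
  | of {γ δ : Obj k} {f : γ ⟶ δ} (h : S f) : Generated S f
  | comp {γ δ ε : Obj k} {f : γ ⟶ δ} {g : δ ⟶ ε} (hf : Generated S f) (hg : Generated S g) :
      Generated S (f ≫ g)
  | tensor {γ δ γ' δ' : Obj k} {f : γ ⟶ δ} {g : γ' ⟶ δ'} (hf : Generated S f)
      (hg : Generated S g) :
      Generated S (tensorHom f g)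
  | adj {γ δ : Obj k} {f : γ ⟶ δ} (hf : Generated S f) : Generated S (adjoint f)

end Tubular

namespace Tubular

open Obj

variable {k : ℕ}

/-! A morphism whose outermost partition has a single block is generated, and every morphism is
assembled from such pieces.

A one-block morphism with inner part `φ` is treated by `singleBlock_eq`: merge all upper tubes into
one, apply `Ψ(φ)` inside it, and split the result into the lower tubes. Merging is the morphism
`collect`. By `collect_cons` it merges all tubes but the first and then applies the adjoint of a
splitting. The recursion ends at the cap (no tube) or at `Ψ(id)` (one tube), so each family of
generators has its own role.

An arbitrary morphism is treated by induction on the number of its outermost ellipses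
(`generated_of_width_le`). Walk around the diagram, along the upper row from left to right and back
along the lower row. Some block of a non-empty non-crossing partition has no gaps along this walk
(`NCPart.exists_convex_block`). If it meets both rows, it consists of the right ends of both, and
the morphism is the tensor product of a smaller one and a one-block one (`eq_tensorHom`). If it lies
in the upper row, it is an interval there; the morphism first closes this interval by a one-block
morphism to the unit and then does the rest (`eq_cut_comp`). A block in the lower row is moved to
the upper row by the adjoint.

The deeper levels need no combinatorics of their own. Blocks separated at depth `0` stay separated
at all depths (`Hom.nested_top`), and inside a single outermost block the deeper levels form a
morphism between the tensor products of the contents (`exists_eq_singleBlock`). -/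

/-! ### Embeddings of objects -/

/-- An inclusion of the sequence of tubes of `γ'` as a subsequence of the tubes of `γ`. -/
structure Emb (γ' γ : Obj (k + 1)) where
  toFun : ℕ → ℕ
  mono : StrictMono toFun
  get : ∀ i α, γ'.tubes[i]? = some α → γ.tubes[toFun i]? = some α

namespace Emb

variable {γ' γ : Obj (k + 1)} {j : ℕ}

/-- The map on nodes induced by an embedding. -/
def node (e : Emb γ' γ) (x : Node γ' j) : Node γ j :=
  ⟨e.toFun x.1.headI :: x.1.tail, by
    obtain ⟨i, t, hx, ht⟩ := x.exists_cons
    have h := x.2.2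
    rw [hx] at h ⊢
    obtain ⟨α, hα, h⟩ := h
    exact ⟨by simpa using ht, α, e.get _ _ hα, h⟩⟩

theorem node_strictMono (e : Emb γ' γ) : StrictMono (e.node : Node γ' j → Node γ j) := by
  intro x y h
  obtain ⟨i, s, hx, -⟩ := x.exists_cons
  obtain ⟨i', s', hy, -⟩ := y.exists_cons
  have h : x.1 < y.1 := h
  change e.toFun x.1.headI :: x.1.tail < e.toFun y.1.headI :: y.1.tail
  rw [hx, hy, List.cons_lt_cons_iff] at h
  rw [hx, hy, List.cons_lt_cons_iff]
  rcases h with h | ⟨rfl, h⟩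
  · exact .inl (e.mono h)
  · exact .inr ⟨rfl, h⟩

theorem parent_node (e : Emb γ' γ) (x : Node γ' (j + 1)) :
    parent (e.node x) = e.node (parent x) := by
  obtain ⟨x, hx, hn⟩ := x
  match x, hx, hn with
  | i :: c :: t, hx, hn => rfl

/-- The inclusion of the left factor of a tensor product. -/
def inl (γ δ : Obj (k + 1)) : Emb γ (tensor γ δ) where
  toFun i := i
  mono := strictMono_id
  get _ _ h :=
    (List.getElem?_append_left (List.getElem?_eq_some_iff.1 h).1).trans h

/-- The inclusion of the right factor of a tensor product. -/
def inr (γ δ : Obj (k + 1)) : Emb δ (tensor γ δ) where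
  toFun i := γ.width + i
  mono _ _ h := Nat.add_lt_add_left h _
  get i _ h := by
    refine (List.getElem?_append_right (Nat.le_add_right γ.tubes.length i)).trans ?_
    rw [Nat.add_sub_cancel_left]
    exact h

/-- The inclusion of the outer factors of a triple tensor product. -/
def sides (γ ε δ : Obj (k + 1)) : Emb (tensor γ (tensor unit δ)) (tensor γ (tensor ε δ)) where
  -- Positions in the right factor jump over `ε`. The factor `unit` in the source occupies no
  -- position; it makes the source literally the target of `id ⊗ (u ⊗ id)` for `u : ε ⟶ unit`.
  toFun i := if i < γ.width then i else i + ε.width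
  mono i j h := by dsimp only; split_ifs <;> omega
  get i α h := by
    have h : (γ.tubes ++ δ.tubes)[i]? = some α := h
    change (γ.tubes ++ (ε.tubes ++ δ.tubes))[if i < γ.tubes.length then i else
      i + ε.tubes.length]? = some α
    split_ifs with hi
    · rwa [List.getElem?_append_left hi] at h ⊢
    · rw [List.getElem?_append_right (by omega)] at h
      rwa [List.getElem?_append_right (by omega), List.getElem?_append_right (by omega),
        show i + ε.tubes.length - γ.tubes.length - ε.tubes.length = i - γ.tubes.length by omega]

theorem sides_inl (γ ε δ : Obj (k + 1)) (x : Node γ j) :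
    (sides γ ε δ).node ((inl γ (tensor unit δ)).node x) = (inl γ (tensor ε δ)).node x := by
  obtain ⟨i, t, hx, -⟩ := x.exists_cons
  have h := x.2.2
  apply Subtype.ext
  rw [hx] at h
  simp [node, sides, inl, hx, h.lt_width]

theorem sides_inr (γ ε δ : Obj (k + 1)) (x : Node δ j) :
    (sides γ ε δ).node ((inr γ (tensor unit δ)).node ((inr unit δ).node x)) =
      (inr γ (tensor ε δ)).node ((inr ε δ).node x) := by
  apply Subtype.ext
  have : (unit : Obj (k + 1)).width = 0 := rfl
  simp [node, sides, inr, this]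
  omega

end Emb

/-! ### Nodes and blocks of tensor products -/

theorem split_inl {γ δ : Obj (k + 1)} {j : ℕ} (x : Node γ j) :
    split ((Emb.inl γ δ).node x) = toLex (.inl x) := by
  obtain ⟨i, t, hx, -⟩ := x.exists_cons
  have h := x.2.2
  rw [hx] at h
  have h := h.lt_width
  unfold split
  rw [dif_pos (by simpa [Emb.node, Emb.inl, hx] using h)]
  congr 2
  apply Subtype.ext
  simp [Emb.node, Emb.inl, hx]

theorem split_inr {γ δ : Obj (k + 1)} {j : ℕ} (x : Node δ j) :
    split ((Emb.inr γ δ).node x) = toLex (.inr x) := by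
  obtain ⟨i, t, hx, -⟩ := x.exists_cons
  unfold split
  rw [dif_neg (by simp [Emb.node, Emb.inr, hx])]
  congr 2
  apply Subtype.ext
  simp [Emb.node, Emb.inr, hx]

theorem node_tensor_cases {γ δ : Obj (k + 1)} {j : ℕ} (x : Node (tensor γ δ) j) :
    (∃ a, x = (Emb.inl γ δ).node a) ∨ ∃ a, x = (Emb.inr γ δ).node a := by
  rcases h : split x with a | a
  · exact .inl ⟨a, split_strictMono.injective (h.trans (split_inl a).symm)⟩
  · exact .inr ⟨a, split_strictMono.injective (h.trans (split_inr a).symm)⟩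

theorem Node.isEmpty_unit {j : ℕ} (x : Node (unit : Obj (k + 1)) j) : False := by
  obtain ⟨i, t, hx, -⟩ := x.exists_cons
  have h := x.2.2
  rw [hx] at h
  exact Nat.not_lt_zero _ h.lt_width

/-- The inclusion of the left factor, on upper and lower nodes. -/
def ptL (γ δ γ' δ' : Obj (k + 1)) {j : ℕ} :
    Node γ j ⊕ Node δ j → Node (tensor γ γ') j ⊕ Node (tensor δ δ') j :=
  Sum.map (Emb.inl _ _).node (Emb.inl _ _).node

/-- The inclusion of the right factor, on upper and lower nodes. -/
def ptR (γ δ γ' δ' : Obj (k + 1)) {j : ℕ} :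
    Node γ' j ⊕ Node δ' j → Node (tensor γ γ') j ⊕ Node (tensor δ δ') j :=
  Sum.map (Emb.inr _ _).node (Emb.inr _ _).node

section tensorRel

variable {γ δ γ' δ' : Obj (k + 1)} {j : ℕ}

theorem regroup_ptL (x : Node γ j ⊕ Node δ j) :
    NCPart.regroup ((ptL γ δ γ' δ' x).map split split) = .inl x := by
  rcases x with x | x <;> simp [ptL, split_inl, NCPart.regroup]

theorem regroup_ptR (x : Node γ' j ⊕ Node δ' j) :
    NCPart.regroup ((ptR γ δ γ' δ' x).map split split) = .inr x := by
  rcases x with x | x <;> simp [ptR, split_inr, NCPart.regroup]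

theorem pt_cases (x : Node (tensor γ γ') j ⊕ Node (tensor δ δ') j) :
    (∃ a, x = ptL γ δ γ' δ' a) ∨ ∃ a, x = ptR γ δ γ' δ' a := by
  rcases x with x | x <;> rcases node_tensor_cases x with ⟨a, rfl⟩ | ⟨a, rfl⟩
  · exact .inl ⟨.inl a, rfl⟩
  · exact .inr ⟨.inl a, rfl⟩
  · exact .inl ⟨.inr a, rfl⟩
  · exact .inr ⟨.inr a, rfl⟩

/-- Replaces `split` and `regroup` by the inclusions of the two factors, so that later arguments can
treat each factor separately. -/
theorem tensor_rel (f : γ ⟶ δ) (g : γ' ⟶ δ')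
    (x y : Node (tensor γ γ') j ⊕ Node (tensor δ δ') j) :
    ((tensorHom f g).level j).rel x y ↔
      (∃ a b, (f.level j).rel a b ∧ x = ptL γ δ γ' δ' a ∧ y = ptL γ δ γ' δ' b) ∨
      ∃ a b, (g.level j).rel a b ∧ x = ptR γ δ γ' δ' a ∧ y = ptR γ δ γ' δ' b := by
  change Sum.LiftRel (f.level j).rel (g.level j).rel
      (NCPart.regroup (x.map split split)) (NCPart.regroup (y.map split split)) ↔ _
  constructor
  · intro h
    rcases pt_cases x with ⟨a, rfl⟩ | ⟨a, rfl⟩ <;> rcases pt_cases y with ⟨b, rfl⟩ | ⟨b, rfl⟩ <;>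
      simp only [regroup_ptL, regroup_ptR] at h <;> cases h
    · rename_i h; exact .inl ⟨a, b, h, rfl, rfl⟩
    · rename_i h; exact .inr ⟨a, b, h, rfl, rfl⟩
  · rintro (⟨a, b, h, rfl, rfl⟩ | ⟨a, b, h, rfl, rfl⟩)
    · rw [regroup_ptL, regroup_ptL]; exact .inl h
    · rw [regroup_ptR, regroup_ptR]; exact .inr h

end tensorRel

/-! ### Restriction to subsequences and splitting into tensor factors -/

/-- The part of a morphism on subsequences of the upper and lower tubes. -/
def Hom.restrict {γ δ γ' δ' : Obj (k + 1)} (f : γ ⟶ δ) (e : Emb γ' γ) (e' : Emb δ' δ) :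
    γ' ⟶ δ' :=
  { level := fun j => (Hom.level f j).comap e.node e'.node e.node_strictMono e'.node_strictMono
    nested := fun j x y h => by
      have e : ∀ x : Node γ' (j + 1) ⊕ Node δ' (j + 1), (x.map parent parent).map e.node e'.node =
          (x.map e.node e'.node).map parent parent := by
        rintro (x | x) <;> simp only [Sum.map_inl, Sum.map_inr, Emb.parent_node]
      change (Hom.level f j).rel ((x.map parent parent).map _ _) ((y.map parent parent).map _ _)
      rw [e, e]
      exact Hom.nested f j _ _ h }

theorem hom_ext {γ δ : Obj k} {f g : γ ⟶ δ}
    (h : ∀ j x y, (Hom.level f j).rel x y ↔ (Hom.level g j).rel x y) : f = g :=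
  Hom.ext (funext fun j => NCPart.ext (Setoid.ext (h j)))

theorem id_rel {γ : Obj k} {j : ℕ} (x y : Node γ j ⊕ Node γ j) :
    (Hom.level (𝟙 γ) j).rel x y ↔
      Sum.elim (_root_.id : Node γ j → _) _root_.id x = Sum.elim _root_.id _root_.id y :=
  Iff.rfl

/-- The outermost ellipse around a node. -/
def top {γ : Obj (k + 1)} : {j : ℕ} → Node γ j → Node γ 0
  | 0, x => x
  | _ + 1, x => top (parent x)

theorem top_node {γ' γ : Obj (k + 1)} (e : Emb γ' γ) : ∀ {j : ℕ} (x : Node γ' j),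
    top (e.node x) = e.node (top x)
  | 0, _ => rfl
  | j + 1, x => by rw [top, e.parent_node, top_node e, top]

/-- Iterated nesting. Statements that two sets of tubes are not connected thereby need to be checked
at depth `0` only. -/
theorem Hom.nested_top {γ δ : Obj (k + 1)} (f : γ ⟶ δ) : ∀ {j : ℕ} {x y : Node γ j ⊕ Node δ j},
    (Hom.level f j).rel x y → (Hom.level f 0).rel (x.map top top) (y.map top top)
  | 0, x, y, h => by rcases x with x | x <;> rcases y with y | y <;> exact h
  | j + 1, x, y, h => by
    have := Hom.nested_top f (Hom.nested f j _ _ h)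
    rcases x with x | x <;> rcases y with y | y <;> exact this

theorem inl_node_ne_inr_node {γ δ : Obj (k + 1)} {j : ℕ} (a : Node γ j) (b : Node δ j) :
    (Emb.inl γ δ).node a ≠ (Emb.inr γ δ).node b := by
  intro h
  have := congrArg split h
  rw [split_inl, split_inr] at this
  cases this

/-- A morphism none of whose blocks meets both halves is a tensor product. -/
theorem eq_tensorHom {γ δ γ' δ' : Obj (k + 1)} (f : tensor γ γ' ⟶ tensor δ δ')
    (h : ∀ a b, ¬ (Hom.level f 0).rel (ptL γ δ γ' δ' a) (ptR γ δ γ' δ' b)) :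
    f = tensorHom (f.restrict (Emb.inl _ _) (Emb.inl _ _))
      (f.restrict (Emb.inr _ _) (Emb.inr _ _)) := by
  have h' : ∀ j (a : Node γ j ⊕ Node δ j) (b : Node γ' j ⊕ Node δ' j),
      ¬ (Hom.level f j).rel (ptL γ δ γ' δ' a) (ptR γ δ γ' δ' b) := by
    intro j a b hab
    apply h (a.map top top) (b.map top top)
    have := Hom.nested_top f hab
    rcases a with a | a <;> rcases b with b | b <;>
      simpa [ptL, ptR, top_node] using this
  refine hom_ext fun j x y => ?_
  rw [tensor_rel]
  constructor
  · intro hxy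
    rcases pt_cases x with ⟨a, rfl⟩ | ⟨a, rfl⟩ <;> rcases pt_cases y with ⟨b, rfl⟩ | ⟨b, rfl⟩
    · exact .inl ⟨a, b, hxy, rfl, rfl⟩
    · exact absurd hxy (h' _ _ _)
    · exact absurd (Setoid.symm' _ hxy) (h' _ _ _)
    · exact .inr ⟨a, b, hxy, rfl, rfl⟩
  · rintro (⟨a, b, hab, rfl, rfl⟩ | ⟨a, b, hab, rfl, rfl⟩) <;> exact hab

theorem tensorHom_id (γ δ : Obj (k + 1)) : tensorHom (𝟙 γ) (𝟙 δ) = 𝟙 (tensor γ δ) := by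
  refine hom_ext fun j x y => ?_
  rw [tensor_rel, id_rel]
  constructor
  · rintro (⟨a, b, h, rfl, rfl⟩ | ⟨a, b, h, rfl, rfl⟩) <;> rw [id_rel] at h <;>
      rcases a with a | a <;> rcases b with b | b <;> cases h <;> rfl
  · intro h
    -- Related points of an identity diagram are copies, upper or lower, of one node `z`; the factor
    -- containing `z` decides which alternative of `tensor_rel` applies.
    have : ∀ x : Node (tensor γ δ) j ⊕ Node (tensor γ δ) j, ∀ z,
        Sum.elim _root_.id _root_.id x = z → x = .inl z ∨ x = .inr z := by
      rintro (x | x) z rfl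
      · exact .inl rfl
      · exact .inr rfl
    have hx := this x _ rfl
    have hy := this y _ h.symm
    generalize Sum.elim (_root_.id : Node (tensor γ δ) j → _) _root_.id x = z at hx hy
    clear h
    rcases node_tensor_cases z with ⟨a, rfl⟩ | ⟨a, rfl⟩
    · left
      rcases hx with rfl | rfl <;> rcases hy with rfl | rfl
      · exact ⟨.inl a, .inl a, rfl, rfl, rfl⟩
      · exact ⟨.inl a, .inr a, rfl, rfl, rfl⟩
      · exact ⟨.inr a, .inl a, rfl, rfl, rfl⟩
      · exact ⟨.inr a, .inr a, rfl, rfl, rfl⟩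
    · right
      rcases hx with rfl | rfl <;> rcases hy with rfl | rfl
      · exact ⟨.inl a, .inl a, rfl, rfl, rfl⟩
      · exact ⟨.inl a, .inr a, rfl, rfl, rfl⟩
      · exact ⟨.inr a, .inl a, rfl, rfl, rfl⟩
      · exact ⟨.inr a, .inr a, rfl, rfl, rfl⟩

/-! ### Morphisms with a single outermost block -/

/-- Converse of `isNode_tensorList`: the leading index either falls below the width of the first
factor or, after subtracting that width, addresses the remaining factors. -/
theorem exists_of_isNode_tensorList : ∀ (l : List (Obj k)) (n : ℕ) (t : List ℕ),
    IsNode (tensorList l) (n :: t) →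
      ∃ i c α, l[i]? = some α ∧ IsNode α (c :: t) ∧ n = offset l i + c
  | [], n, t, h => by
    cases k with
    | zero => exact h.elim
    | succ k => exact absurd h.lt_width (Nat.not_lt_zero _)
  | [β], n, t, h => ⟨0, n, β, rfl, h, by simp [offset]⟩
  | β :: β' :: l, n, t, h => by
    by_cases hn : n < β.width
    · exact ⟨0, n, β, rfl, (isNode_tensor_left hn).1 h, by simp [offset]⟩
    · obtain ⟨m, rfl⟩ := Nat.exists_eq_add_of_le (not_lt.1 hn)
      obtain ⟨i, c, α, hα, hc, rfl⟩ :=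
        exists_of_isNode_tensorList (β' :: l) m t (isNode_tensor_right.1 h)
      exact ⟨i + 1, c, α, hα, hc, by simp [offset, add_assoc]⟩

theorem content_surjective {γ : Obj (k + 1)} {j : ℕ} :
    Function.Surjective (content : Node γ (j + 1) → Node (tensorList γ.tubes) j) := by
  rintro ⟨x, hx, h⟩
  match x, hx, h with
  | n :: t, hx, h =>
    obtain ⟨i, c, α, hα, hc, rfl⟩ := exists_of_isNode_tensorList _ _ _ h
    exact ⟨⟨i :: c :: t, by simpa using hx, α, hα, .inr hc⟩, rfl⟩

/-- The nodes inside the outermost ellipses are the nodes of the tensor product of the contents. -/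
noncomputable def contentIso (γ : Obj (k + 1)) (j : ℕ) :
    Node γ (j + 1) ≃o Node (tensorList γ.tubes) j :=
  content_strictMono.orderIsoOfSurjective content content_surjective

theorem contentIso_apply {γ : Obj (k + 1)} {j : ℕ} (x : Node γ (j + 1)) :
    contentIso γ j x = content x := rfl

theorem contentIso_symm_parent {γ : Obj (k + 1)} {j : ℕ} (x : Node (tensorList γ.tubes) (j + 1)) :
    (contentIso γ j).symm (parent x) = parent ((contentIso γ (j + 1)).symm x) := by
  rw [OrderIso.symm_apply_eq, contentIso_apply, content_parent, ← contentIso_apply,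
    OrderIso.apply_symm_apply]

theorem singleBlock_rel_succ {γ δ : Obj (k + 1)} (φ : tensorList γ.tubes ⟶ tensorList δ.tubes)
    {j : ℕ} (x y : Node γ (j + 1) ⊕ Node δ (j + 1)) :
    (Hom.level (singleBlock φ) (j + 1)).rel x y ↔
      (Hom.level φ j).rel (x.map content content) (y.map content content) := Iff.rfl

theorem singleBlock_rel_zero {γ δ : Obj (k + 1)} (φ : tensorList γ.tubes ⟶ tensorList δ.tubes)
    (x y : Node γ 0 ⊕ Node δ 0) : (Hom.level (singleBlock φ) 0).rel x y := trivial

/-- At every depth `content` is an order isomorphism. Relabelling the levels `1, 2, …` along its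
inverse gives the levels `0, 1, …` of the inner morphism, while level `0` carries no information. -/
theorem exists_eq_singleBlock {γ δ : Obj (k + 1)} (f : γ ⟶ δ)
    (h : ∀ x y, (Hom.level f 0).rel x y) : ∃ φ, f = singleBlock φ := by
  let φ : Hom (tensorList γ.tubes) (tensorList δ.tubes) :=
    { level := fun j => (Hom.level f (j + 1)).comap (contentIso γ j).symm (contentIso δ j).symm
        (contentIso γ j).symm.strictMono (contentIso δ j).symm.strictMono
      nested := fun j x y h => by
        have e : ∀ x : Node (tensorList γ.tubes) (j + 1) ⊕ Node (tensorList δ.tubes) (j + 1),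
            (x.map parent parent).map (contentIso γ j).symm (contentIso δ j).symm =
            (x.map (contentIso γ (j + 1)).symm (contentIso δ (j + 1)).symm).map parent parent := by
          rintro (x | x) <;> simp only [Sum.map_inl, Sum.map_inr, contentIso_symm_parent]
        change (Hom.level f (j + 1)).rel ((x.map parent parent).map _ _)
          ((y.map parent parent).map _ _)
        rw [e, e]
        exact Hom.nested f (j + 1) _ _ h }
  refine ⟨φ, hom_ext fun j x y => ?_⟩
  cases j with
  | zero => exact iff_of_true (h _ _) (singleBlock_rel_zero _ _ _)
  | succ j =>
    rw [singleBlock_rel_succ]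
    have e : ∀ x : Node γ (j + 1) ⊕ Node δ (j + 1),
        (x.map content content).map (contentIso γ j).symm (contentIso δ j).symm = x := by
      rintro (x | x) <;> simp [← contentIso_apply]
    change _ ↔ (Hom.level f (j + 1)).rel ((x.map content content).map _ _)
      ((y.map content content).map _ _)
    rw [e, e]

/-! ### Stacks as generated equivalence relations -/

theorem comp_rel {γ δ ε : Obj k} (f : γ ⟶ δ) (g : δ ⟶ ε) {j : ℕ} (x y : Node γ j ⊕ Node ε j) :
    (Hom.level (f ≫ g) j).rel x y ↔
      NCPart.stack (Hom.level f j).rel (Hom.level g j).rel (NCPart.outer x) (NCPart.outer y) :=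
  Iff.rfl

theorem adjoint_rel {γ δ : Obj k} (f : γ ⟶ δ) {j : ℕ} (x y : Node δ j ⊕ Node γ j) :
    (Hom.level (adjoint f) j).rel x y ↔ (Hom.level f j).rel x.swap y.swap := Iff.rfl

theorem adjoint_adjoint {γ δ : Obj k} (f : γ ⟶ δ) : adjoint (adjoint f) = f :=
  hom_ext fun j x y => by rw [adjoint_rel, adjoint_rel, Sum.swap_swap, Sum.swap_swap]

/-- Blocks of a stack lie in the classes of every equivalence relation that contains the blocks of
both diagrams. -/
theorem stack_le {A B C : Type} {p : Setoid (A ⊕ B)} {q : Setoid (B ⊕ C)} (T : Setoid (A ⊕ B ⊕ C))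
    (hp : ∀ x y, p x y → T (NCPart.upper x) (NCPart.upper y))
    (hq : ∀ x y, q x y → T (.inr x) (.inr y)) {u v : A ⊕ B ⊕ C} (h : NCPart.stack p q u v) :
    T u v := by
  induction h with
  | rel u v h =>
    cases h with
    | top h => exact hp _ _ h
    | bot h => exact hq _ _ h
  | refl u => exact T.refl _
  | symm _ _ _ ih => exact T.symm ih
  | trans _ _ _ _ _ ih ih' => exact T.trans ih ih'

theorem stack_top {A B C : Type} {p : Setoid (A ⊕ B)} {q : Setoid (B ⊕ C)} {x y : A ⊕ B}
    (h : p x y) : NCPart.stack p q (NCPart.upper x) (NCPart.upper y) := .rel _ _ (.top h)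

theorem stack_bot {A B C : Type} {p : Setoid (A ⊕ B)} {q : Setoid (B ⊕ C)} {x y : B ⊕ C}
    (h : q x y) : NCPart.stack p q (.inr x) (.inr y) := .rel _ _ (.bot h)

/-- Stacking commutes with bijective relabellings of the points. -/
theorem stack_equiv {A B C A' B' C' : Type} (p : Setoid (A' ⊕ B')) (q : Setoid (B' ⊕ C'))
    (a : A ≃ A') (b : B ≃ B') (c : C ≃ C') (u v : A ⊕ B ⊕ C) :
    NCPart.stack (p.comap (Sum.map a b)) (q.comap (Sum.map b c)) u v ↔
      NCPart.stack p q (u.map a (Sum.map b c)) (v.map a (Sum.map b c)) := by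
  constructor
  · refine stack_le (Setoid.comap (Sum.map a (Sum.map b c)) (NCPart.stack p q)) ?_ ?_
    · intro x y h
      have := stack_top (q := q) h
      rcases x with x | x <;> rcases y with y | y <;> exact this
    · intro x y h
      exact stack_bot h
  · intro h
    have : ∀ u v, NCPart.stack p q u v → Setoid.comap (Sum.map a.symm (Sum.map b.symm c.symm))
        (NCPart.stack (p.comap (Sum.map a b)) (q.comap (Sum.map b c))) u v := by
      intro u v
      refine stack_le _ ?_ ?_
      · intro x y h
        have h : p.comap (Sum.map a b) (x.map a.symm b.symm) (y.map a.symm b.symm) := by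
          change p _ _
          simpa using h
        have := stack_top (q := q.comap (Sum.map b c)) h
        rcases x with x | x <;> rcases y with y | y <;> exact this
      · intro x y h
        have h : q.comap (Sum.map b c) (x.map b.symm c.symm) (y.map b.symm c.symm) := by
          change q _ _
          simpa using h
        exact stack_bot h
    have := this _ _ h
    change NCPart.stack _ _ _ _ at this
    simpa using this

/-- Composition of morphisms with a single outermost block takes place inside this block. -/
theorem singleBlock_comp {γ δ ε : Obj (k + 1)} (φ : tensorList γ.tubes ⟶ tensorList δ.tubes)
    (ψ : tensorList δ.tubes ⟶ tensorList ε.tubes) (z : Node δ 0) :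
    singleBlock φ ≫ singleBlock ψ = singleBlock (γ := γ) (δ := ε) (φ ≫ ψ) := by
  refine hom_ext fun j x y => ?_
  cases j with
  | zero =>
    refine iff_of_true ?_ (singleBlock_rel_zero _ _ _)
    rw [comp_rel]
    -- The middle point `z` holds the two blocks together; over an empty middle row the composite
    -- could fall apart into an upper and a lower block.
    have : ∀ x : Node γ 0 ⊕ Node ε 0, NCPart.stack (Hom.level (singleBlock φ) 0).rel
        (Hom.level (singleBlock ψ) 0).rel (NCPart.outer x) (.inr (.inl z)) := by
      rintro (x | x)
      · exact stack_top (x := .inl x) (y := .inr z) (singleBlock_rel_zero _ _ _)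
      · exact stack_bot (x := .inr x) (y := .inl z) (singleBlock_rel_zero _ _ _)
    exact Setoid.trans' _ (this x) (Setoid.symm' _ (this y))
  | succ j =>
    rw [comp_rel, singleBlock_rel_succ, comp_rel]
    have := stack_equiv (Hom.level φ j).rel (Hom.level ψ j).rel (contentIso γ j).toEquiv
      (contentIso δ j).toEquiv (contentIso ε j).toEquiv (NCPart.outer x) (NCPart.outer y)
    refine this.trans ?_
    rcases x with x | x <;> rcases y with y | y <;> exact Iff.rfl

/-! ### One-block morphisms through a single tube -/

/-- The morphism that collects all tubes of an object in a single tube. -/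
def collect (γ : Obj (k + 1)) : γ ⟶ Psi (tensorList γ.tubes) :=
  singleBlock (γ := γ) (δ := Psi (tensorList γ.tubes)) (𝟙 (tensorList γ.tubes))

/-- The nodes of `Psi α` inside its only outermost ellipse, as nodes of `α`. -/
def psiContent {α : Obj k} {j : ℕ} (x : Node (Psi α) (j + 1)) : Node α j :=
  content (γ := Psi α) x

theorem psiContent_injective {α : Obj k} {j : ℕ} :
    Function.Injective (psiContent : Node (Psi α) (j + 1) → Node α j) :=
  content_strictMono.injective

theorem psiContent_surjective {α : Obj k} {j : ℕ} :
    Function.Surjective (psiContent : Node (Psi α) (j + 1) → Node α j) :=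
  content_surjective (γ := Psi α)

theorem collect_rel_succ (γ : Obj (k + 1)) {j : ℕ}
    (x y : Node γ (j + 1) ⊕ Node (Psi (tensorList γ.tubes)) (j + 1)) :
    (Hom.level (collect γ) (j + 1)).rel x y ↔
      Sum.elim content psiContent x = Sum.elim content psiContent y := by
  rcases x with x | x <;> rcases y with y | y <;> exact Iff.rfl

/-- The node of `Psi α` of depth `0`. -/
def psiNode (α : Obj k) : Node (Psi α) 0 := ⟨[0], rfl, α, rfl, .inl rfl⟩

/-- Both intermediate objects are single tubes, hence non-empty, so `singleBlock_comp` applies twice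
even if `γ` or `δ` is the unit. The inner morphisms contributed by the outer factors are identities.
-/
theorem singleBlock_eq {γ δ : Obj (k + 1)} (φ : tensorList γ.tubes ⟶ tensorList δ.tubes) :
    singleBlock φ = collect γ ≫ PsiMap φ ≫ adjoint (collect δ) := by
  have e : adjoint (collect δ) = singleBlock (γ := Psi (tensorList δ.tubes)) (δ := δ)
      (𝟙 (tensorList δ.tubes)) := by
    refine hom_ext fun j x y => ?_
    cases j with
    | zero => exact iff_of_true trivial trivial
    | succ j =>
      rw [adjoint_rel, collect_rel_succ]
      rcases x with x | x <;> rcases y with y | y <;> exact Iff.rfl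
  -- The types match only after reducing `tensorList [τ]` to `τ`, hence the explicit objects and the
  -- use of `congrArg` below.
  have h1 := singleBlock_comp (γ := Psi (tensorList γ.tubes)) (δ := Psi (tensorList δ.tubes))
    (ε := δ) φ (𝟙 (tensorList δ.tubes)) (psiNode _)
  have h2 := singleBlock_comp (γ := γ) (δ := Psi (tensorList γ.tubes)) (ε := δ)
    (𝟙 (tensorList γ.tubes)) φ (psiNode _)
  have h3 : φ ≫ 𝟙 (tensorList δ.tubes) = φ := Category.comp_id _
  have h4 : 𝟙 (tensorList γ.tubes) ≫ φ = φ := Category.id_comp _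
  refine (congrArg (singleBlock (γ := γ) (δ := δ)) h4.symm).trans (h2.symm.trans ?_)
  rw [e]
  refine congrArg (collect γ ≫ ·) (Eq.trans ?_ h1.symm)
  exact congrArg (singleBlock (γ := Psi (tensorList γ.tubes)) (δ := δ)) h3.symm

/-! ### Identities are generated -/

theorem generated_id_psi (α : Obj k) : Generated (IsGenerator k) (𝟙 (Psi α)) := by
  have : 𝟙 (Psi α) = PsiMap (𝟙 α) := by
    -- `Psi α` has only one node of depth `0`, so its identity has a single outermost block.
    obtain ⟨φ, h⟩ := exists_eq_singleBlock (𝟙 (Psi α)) (by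
      have : ∀ x : Node (Psi α) 0, x = psiNode α := by
        intro x
        obtain ⟨i, t, hx, ht⟩ := x.exists_cons
        have h := x.2.2
        rw [hx] at h
        have : i < 1 := h.lt_width
        apply Subtype.ext
        rw [hx, List.length_eq_zero_iff.1 ht, Nat.lt_one_iff.1 this]
        rfl
      intro x y
      rw [id_rel]
      exact (this _).trans (this _).symm)
    refine hom_ext fun j x y => ?_
    cases j with
    | zero => rw [h]; exact iff_of_true (singleBlock_rel_zero _ _ _) (singleBlock_rel_zero _ _ _)
    | succ j =>
      change _ ↔ Sum.elim _root_.id _root_.id _ = Sum.elim _root_.id _root_.id _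
      rw [id_rel]
      rcases x with x | x <;> rcases y with y | y <;>
        exact (content_strictMono.injective.eq_iff).symm
  rw [this]
  exact .of (.tubed _)

theorem hom_unit_eq (f g : (unit : Obj (k + 1)) ⟶ unit) : f = g :=
  hom_ext fun j x y => by rcases x with x | x <;> exact x.isEmpty_unit.elim

/-- `Generated` does not include identities by definition. The empty diagram arises as the cap
closed by its adjoint, since the resulting block has no outer point and disappears. -/
theorem generated_unit (f : (unit : Obj (k + 1)) ⟶ unit) : Generated (IsGenerator k) f := by
  rw [hom_unit_eq f (cap k ≫ adjoint (cap k))]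
  exact .comp (.of .cap) (.adj (.of .cap))

theorem generated_id : ∀ γ : Obj (k + 1), Generated (IsGenerator k) (𝟙 γ)
  | [] => generated_unit _
  | α :: l => by
    have e : tensorHom (𝟙 (Psi α)) (𝟙 (mk l)) = 𝟙 (mk (α :: l)) := tensorHom_id _ _
    change Generated _ (𝟙 (mk (α :: l)))
    rw [← e]
    exact .tensor (generated_id_psi α) (generated_id l)

/-! ### Collecting tubes one at a time -/

theorem offset_cons (α : Obj k) (l : List (Obj k)) (i : ℕ) :
    offset (α :: l) (i + 1) = α.width + offset l i := by simp [offset]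

/-- At depth `0` everything is connected to the one lower tube. Below that, each diagram joins
exactly the points that stand for the same node of `α ⊗ τ`, and so does the stack. -/
theorem collect_cons (α β : Obj k) (l : List (Obj k)) :
    collect (mk (α :: β :: l)) = tensorHom (𝟙 (Psi α)) (collect (mk (β :: l))) ≫
      adjoint (splitting α (tensorList (β :: l))) := by
  set δ : Obj (k + 1) := mk (β :: l)
  set τ : Obj k := tensorList (β :: l)
  refine hom_ext fun j x y => ?_
  cases j with
  | zero =>
    refine iff_of_true (singleBlock_rel_zero _ _ _) ?_
    refine (comp_rel (tensorHom (𝟙 (Psi α)) (collect δ)) (adjoint (splitting α τ)) x y).2 ?_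
    let z : Node (Psi (tensor α τ)) 0 := psiNode _
    have h1 : ∀ x : Node (tensor (Psi α) (Psi τ)) 0,
        NCPart.stack (Hom.level (tensorHom (𝟙 (Psi α)) (collect δ)) 0).rel
        (Hom.level (adjoint (splitting α τ)) 0).rel (.inr (.inl x)) (.inr (.inr z)) := fun x =>
      stack_bot (x := .inl x) (y := .inr z) trivial
    have h2 : ∀ x, NCPart.stack (Hom.level (tensorHom (𝟙 (Psi α)) (collect δ)) 0).rel
        (Hom.level (adjoint (splitting α τ)) 0).rel (NCPart.outer x) (.inr (.inr z)) := by
      rintro (x | x)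
      · rcases node_tensor_cases (γ := Psi α) (δ := δ) x with ⟨a, rfl⟩ | ⟨a, rfl⟩
        · exact Setoid.trans' _ (stack_top (x := .inl _) (y := .inr ((Emb.inl _ _).node a))
            ((tensor_rel _ _ _ _).2 (.inl ⟨.inl a, .inr a, rfl, rfl, rfl⟩))) (h1 _)
        · exact Setoid.trans' _ (stack_top (x := .inl _) (y := .inr ((Emb.inr _ _).node (psiNode τ)))
            ((tensor_rel _ _ _ _).2 (.inr ⟨.inl a, .inr (psiNode τ), trivial,
              rfl, rfl⟩))) (h1 _)
      · exact stack_bot (x := .inr x) (y := .inr z) trivial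
    exact Setoid.trans' _ (h2 x) (Setoid.symm' _ (h2 y))
  | succ j =>
    let X := Node (tensor α τ) j
    -- `cA`, `cB`, `cC` label the upper, middle and lower row of the stack by nodes of `α ⊗ τ`; the
    -- goal is that the blocks on the outer rows are the fibres of the labels.
    let cA : Node (tensor (Psi α) δ) (j + 1) → X := content (γ := mk (α :: β :: l))
    let cB : Node (tensor (Psi α) (Psi τ)) (j + 1) → X := content (γ := tensor (Psi α) (Psi τ))
    let cC : Node (Psi (tensor α τ)) (j + 1) → X := psiContent
    have hl : ∀ a : Node (Psi α) (j + 1),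
        cA ((Emb.inl _ _).node a) = cB ((Emb.inl _ _).node a) := by
      rintro ⟨x, hx, h⟩
      match x, hx, h with
      | i :: c :: t, hx, h =>
        have : i < 1 := h.lt_width
        obtain rfl := Nat.lt_one_iff.1 this
        apply Subtype.ext
        simp [cA, cB, content, Emb.node, Emb.inl, contentPath, offset]
    have hr : ∀ (a : Node δ (j + 1)) (b : Node (Psi τ) (j + 1)),
        cA ((Emb.inr _ _).node a) = cB ((Emb.inr _ _).node b) ↔
          (content a : Node τ j) = psiContent b := by
      rintro ⟨x, hx, h⟩ ⟨y, hy, h'⟩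
      match x, hx, h, y, hy, h' with
      | i :: c :: t, hx, h, i' :: c' :: t', hy, h' =>
        have : i' < 1 := h'.lt_width
        obtain rfl := Nat.lt_one_iff.1 this
        refine Subtype.ext_iff.trans (Iff.trans ?_ Subtype.ext_iff.symm)
        change contentPath (α :: β :: l) ((1 + i) :: c :: t) =
          contentPath [α, τ] ((1 + 0) :: c' :: t') ↔
          contentPath (β :: l) (i :: c :: t) = contentPath [τ] (0 :: c' :: t')
        -- Putting `α` in front shifts the offsets on both sides by the same amount, the width of
        -- `α`.
        simp only [contentPath, add_comm 1, offset_cons, List.cons.injEq]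
        exact and_congr_left fun _ => by omega
    have htop : ∀ a, ∃ b, cA a = cB b ∧
        (Hom.level (tensorHom (𝟙 (Psi α)) (collect δ)) (j + 1)).rel (.inl a) (.inr b) := by
      intro a
      rcases node_tensor_cases (γ := Psi α) (δ := δ) a with ⟨a, rfl⟩ | ⟨a, rfl⟩
      · exact ⟨_, hl a, (tensor_rel _ _ _ _).2 (.inl ⟨.inl a, .inr a, rfl, rfl, rfl⟩)⟩
      · obtain ⟨b, hb⟩ := psiContent_surjective (content a : Node τ j)
        exact ⟨_, (hr a b).2 hb.symm, (tensor_rel _ _ _ _).2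
          (.inr ⟨.inl a, .inr b, (collect_rel_succ _ _ _).2 hb.symm, rfl, rfl⟩)⟩
    have hbot : ∀ c, ∃ b, cC c = cB b := by
      intro c
      obtain ⟨b, hb⟩ := content_surjective (γ := tensor (Psi α) (Psi τ)) (cC c)
      exact ⟨b, hb.symm⟩
    have hsplit : ∀ x y : Node (tensor (Psi α) (Psi τ)) (j + 1) ⊕ Node (Psi (tensor α τ)) (j + 1),
        (Hom.level (adjoint (splitting α τ)) (j + 1)).rel x y ↔
          Sum.elim cB cC x = Sum.elim cB cC y := by
      rintro (x | x) (y | y) <;> exact Iff.rfl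
    refine (collect_rel_succ (mk (α :: β :: l)) x y).trans
      (Iff.trans ?_ (comp_rel (tensorHom (𝟙 (Psi α)) (collect δ)) (adjoint (splitting α τ)) x y).symm)
    change Sum.elim cA cC x = Sum.elim cA cC y ↔ _
    constructor
    · intro h
      -- Each outer point is linked to a middle point of equal label. As `cB` is injective, outer
      -- points with equal labels reach the same middle point.
      have key : ∀ x, ∃ b, Sum.elim cA cC x = cB b ∧
          NCPart.stack (Hom.level (tensorHom (𝟙 (Psi α)) (collect δ)) (j + 1)).rel
            (Hom.level (adjoint (splitting α τ)) (j + 1)).rel (NCPart.outer x) (.inr (.inl b)) := by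
        rintro (x | x)
        · obtain ⟨b, hb, h⟩ := htop x
          exact ⟨b, hb, stack_top h⟩
        · obtain ⟨b, hb⟩ := hbot x
          exact ⟨b, hb, stack_bot ((hsplit (.inr x) (.inl b)).2 hb)⟩
      obtain ⟨b, hb, h1⟩ := key x
      obtain ⟨b', hb', h2⟩ := key y
      obtain rfl : b = b' := content_strictMono.injective (hb.symm.trans (h.trans hb'))
      exact Setoid.trans' _ h1 (Setoid.symm' _ h2)
    · intro h
      -- Conversely, having equal labels is an equivalence relation that contains the blocks of both
      -- diagrams.
      have := stack_le (Setoid.ker (Sum.elim cA (Sum.elim cB cC))) ?_ ?_ h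
      · rcases x with x | x <;> rcases y with y | y <;> exact this
      · intro x y h
        change Sum.elim cA (Sum.elim cB cC) _ = Sum.elim cA (Sum.elim cB cC) _
        have aux : ∀ x : Node (tensor (Psi α) δ) (j + 1) ⊕ Node (tensor (Psi α) (Psi τ)) (j + 1),
            Sum.elim cA (Sum.elim cB cC) (NCPart.upper x) = Sum.elim cA cB x := by
          rintro (x | x) <;> rfl
        rw [aux, aux]
        rcases (tensor_rel _ _ _ _).1 h with ⟨a, b, hab, rfl, rfl⟩ | ⟨a, b, hab, rfl, rfl⟩
        · have hab := (id_rel a b).1 hab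
          have : ∀ a, Sum.elim cA cB (ptL (Psi α) (Psi α) δ (Psi τ) a) =
              cB ((Emb.inl _ _).node (Sum.elim _root_.id _root_.id a)) := by
            rintro (a | a)
            · exact hl a
            · rfl
          rw [this, this, hab]
        · have hab := (collect_rel_succ δ a b).1 hab
          have : ∀ a, ∃ b : Node (Psi τ) (j + 1), (Sum.elim content psiContent a : Node τ j) =
              psiContent b ∧
              Sum.elim cA cB (ptR (Psi α) (Psi α) δ (Psi τ) a) = cB ((Emb.inr _ _).node b) := by
            rintro (a | a)
            · obtain ⟨b, hb⟩ := psiContent_surjective (content a : Node τ j)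
              exact ⟨b, hb.symm, (hr a b).2 hb.symm⟩
            · exact ⟨a, rfl, rfl⟩
          obtain ⟨a', ha, ha'⟩ := this a
          obtain ⟨b', hb, hb'⟩ := this b
          obtain rfl : a' = b' := psiContent_injective (ha.symm.trans (hab.trans hb))
          exact ha'.trans hb'.symm
      · exact fun x y h => (hsplit x y).1 h

/-- Collecting no tube is the cap and collecting one tube is `Ψ(id)`, both by definition. -/
theorem generated_collect : ∀ γ : Obj (k + 1), Generated (IsGenerator k) (collect γ)
  | [] => .of .cap
  | [α] => .of (.tubed (𝟙 α))
  | α :: β :: l => by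
    have := collect_cons α β l
    change Generated _ (collect (mk (α :: β :: l)))
    rw [this]
    exact .comp (.tensor (generated_id _) (generated_collect (β :: l))) (.adj (.of (.splitting _ _)))

theorem generated_singleBlock {γ δ : Obj (k + 1)} (φ : tensorList γ.tubes ⟶ tensorList δ.tubes) :
    Generated (IsGenerator k) (singleBlock φ) := by
  rw [singleBlock_eq]
  exact .comp (generated_collect _) (.comp (.of (.tubed _)) (.adj (generated_collect _)))

/-! ### Cutting off an interval of the upper row -/

namespace Emb

variable {j : ℕ}

/-- The identity embedding. -/
def refl (γ : Obj (k + 1)) : Emb γ γ where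
  toFun i := i
  mono := strictMono_id
  get _ _ h := h

/-- The inclusion of the unit object. -/
def ofUnit (γ : Obj (k + 1)) : Emb unit γ where
  toFun i := i
  mono := strictMono_id
  get i α h := by cases (h : ([] : List (Obj k))[i]? = some α)

/-- The inclusion of the middle factor of a triple tensor product. -/
def mid (γ ε δ : Obj (k + 1)) : Emb ε (tensor γ (tensor ε δ)) where
  toFun i := γ.width + i
  mono := (inr γ (tensor ε δ)).mono
  get i α h := (inr γ (tensor ε δ)).get i α ((inl ε δ).get i α h)

theorem mid_node {γ ε δ : Obj (k + 1)} (x : Node ε j) :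
    (mid γ ε δ).node x = (inr γ (tensor ε δ)).node ((inl ε δ).node x) := rfl

theorem refl_node {γ : Obj (k + 1)} (x : Node γ j) : (refl γ).node x = x := by
  obtain ⟨i, t, hx, -⟩ := x.exists_cons
  apply Subtype.ext
  simp [node, refl, hx]

theorem inr_injective {γ δ : Obj (k + 1)} :
    Function.Injective ((inr γ δ).node : Node δ j → _) := (inr γ δ).node_strictMono.injective

end Emb

theorem node_triple_cases {γ ε δ : Obj (k + 1)} {j : ℕ} (x : Node (tensor γ (tensor ε δ)) j) :
    (∃ a, x = (Emb.mid γ ε δ).node a) ∨ ∃ a, x = (Emb.sides γ ε δ).node a := by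
  rcases node_tensor_cases x with ⟨a, rfl⟩ | ⟨a, rfl⟩
  · exact .inr ⟨_, (Emb.sides_inl _ _ _ a).symm⟩
  · rcases node_tensor_cases a with ⟨a, rfl⟩ | ⟨a, rfl⟩
    · exact .inl ⟨a, rfl⟩
    · exact .inr ⟨_, (Emb.sides_inr _ _ _ a).symm⟩

theorem mid_node_ne_sides_node {γ ε δ : Obj (k + 1)} {j : ℕ} (a : Node ε j)
    (b : Node (tensor γ (tensor unit δ)) j) :
    (Emb.mid γ ε δ).node a ≠ (Emb.sides γ ε δ).node b := by
  rcases node_tensor_cases b with ⟨b, rfl⟩ | ⟨b, rfl⟩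
  · rw [Emb.sides_inl, Emb.mid_node]
    exact (inl_node_ne_inr_node _ _).symm
  · rcases node_tensor_cases b with ⟨b, rfl⟩ | ⟨b, rfl⟩
    · exact b.isEmpty_unit.elim
    · rw [Emb.sides_inr, Emb.mid_node]
      exact fun h => inl_node_ne_inr_node _ _ (Emb.inr_injective h)

/-- A morphism factors through the removal of an interval of the upper row that is a block. -/
theorem eq_cut_comp {γ ε γ' δ : Obj (k + 1)} (f : tensor γ (tensor ε γ') ⟶ δ)
    (h : ∀ a y, (Hom.level f 0).rel (.inl ((Emb.mid γ ε γ').node a)) y →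
      ∃ b, y = .inl ((Emb.mid γ ε γ').node b)) :
    f = tensorHom (𝟙 γ) (tensorHom (f.restrict (Emb.mid γ ε γ') (Emb.ofUnit δ)) (𝟙 γ')) ≫
      f.restrict (Emb.sides γ ε γ') (Emb.refl δ) := by
  set u := f.restrict (Emb.mid γ ε γ') (Emb.ofUnit δ)
  set e := tensorHom (𝟙 γ) (tensorHom u (𝟙 γ'))
  set g := f.restrict (Emb.sides γ ε γ') (Emb.refl δ)
  refine hom_ext fun j x y => ?_
  -- The isolation of the middle interval passes to every depth, because the outermost ellipses
  -- around related nodes are related.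
  have hj : ∀ a y, (Hom.level f j).rel (.inl ((Emb.mid γ ε γ').node a)) y →
      ∃ b, y = .inl ((Emb.mid γ ε γ').node b) := by
    intro a y hy
    have := Hom.nested_top f hy
    rw [Sum.map_inl, top_node] at this
    obtain ⟨b, hb⟩ := h _ _ this
    rcases y with y | y
    · rcases node_triple_cases y with ⟨b', rfl⟩ | ⟨b', rfl⟩
      · exact ⟨b', rfl⟩
      · rw [Sum.map_inl, top_node] at hb
        exact absurd (Sum.inl_injective hb).symm (mid_node_ne_sides_node _ _)
    · cases hb
  have hu : ∀ a b : Node ε j, (Hom.level u j).rel (.inl a) (.inl b) ↔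
      (Hom.level f j).rel (.inl ((Emb.mid γ ε γ').node a)) (.inl ((Emb.mid γ ε γ').node b)) :=
    fun _ _ => Iff.rfl
  -- `s` identifies the middle row of the stack with the upper points that survive the cut.
  let s := (Emb.sides γ ε γ').node (j := j)
  have hg : ∀ x y, (Hom.level g j).rel x y ↔
      (Hom.level f j).rel (x.map s _root_.id) (y.map s _root_.id) := by
    have : ∀ x : Node (tensor γ (tensor unit γ')) j ⊕ Node δ j,
        x.map s (Emb.refl δ).node = x.map s _root_.id := by
      rintro (x | x)
      · rfl
      · exact congrArg Sum.inr (Emb.refl_node x)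
    intro x y
    rw [← this, ← this]
    exact Iff.rfl
  have hs : ∀ a, (Hom.level e j).rel (.inl (s a)) (.inr a) := by
    intro a
    rcases node_tensor_cases a with ⟨a, rfl⟩ | ⟨a, rfl⟩
    · exact (tensor_rel _ _ _ _).2 (.inl ⟨.inl a, .inr a, rfl,
        congrArg Sum.inl (Emb.sides_inl _ _ _ a), rfl⟩)
    · rcases node_tensor_cases a with ⟨a, rfl⟩ | ⟨a, rfl⟩
      · exact a.isEmpty_unit.elim
      · exact (tensor_rel _ _ _ _).2 (.inr ⟨.inl ((Emb.inr _ _).node a), .inr _,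
          (tensor_rel _ _ _ _).2 (.inr ⟨.inl a, .inr a, rfl, rfl, rfl⟩),
          congrArg Sum.inl (Emb.sides_inr _ _ _ a), rfl⟩)
  have hm : ∀ a b, (Hom.level u j).rel (.inl a) (.inl b) → (Hom.level e j).rel
      (.inl ((Emb.mid γ ε γ').node a)) (.inl ((Emb.mid γ ε γ').node b)) := by
    intro a b hab
    exact (tensor_rel _ _ _ _).2 (.inr ⟨.inl ((Emb.inl _ _).node a), .inl ((Emb.inl _ _).node b),
      (tensor_rel _ _ _ _).2 (.inl ⟨.inl a, .inl b, hab, rfl, rfl⟩), rfl, rfl⟩)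
  have he : ∀ x y, (Hom.level e j).rel x y →
      (Hom.level f j).rel (.inl (Sum.elim _root_.id s x)) (.inl (Sum.elim _root_.id s y)) := by
    intro x y hxy
    rcases (tensor_rel _ _ _ _).1 hxy with ⟨a, b, hab, rfl, rfl⟩ | ⟨a, b, hab, rfl, rfl⟩
    · have : ∀ a : Node γ j ⊕ Node γ j, Sum.elim _root_.id s
          (ptL γ γ (tensor ε γ') (tensor unit γ') a) =
          (Emb.inl _ _).node (Sum.elim _root_.id _root_.id a) := by
        rintro (a | a)
        · rfl
        · exact Emb.sides_inl _ _ _ a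
      rw [this, this, (id_rel _ _).1 hab]
    · rcases (tensor_rel _ _ _ _).1 hab with ⟨a, b, hab', rfl, rfl⟩ | ⟨a, b, hab', rfl, rfl⟩
      · rcases a with a | a
        · rcases b with b | b
          · exact hab'
          · exact b.isEmpty_unit.elim
        · exact a.isEmpty_unit.elim
      · have : ∀ a : Node γ' j ⊕ Node γ' j, Sum.elim _root_.id s
            (ptR γ γ (tensor ε γ') (tensor unit γ') (ptR ε unit γ' γ' a)) =
            (Emb.inr _ _).node ((Emb.inr _ _).node (Sum.elim _root_.id _root_.id a)) := by
          rintro (a | a)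
          · rfl
          · exact Emb.sides_inr _ _ _ a
        rw [this, this, (id_rel _ _).1 hab']
  rw [comp_rel]
  constructor
  · intro hxy
    -- An outer point of the stack is either cut off, and then all its relations are those of `u`,
    -- or is linked to a point of `g`.
    have cases : ∀ x : Node (tensor γ (tensor ε γ')) j ⊕ Node δ j,
        (∃ a, x = .inl ((Emb.mid γ ε γ').node a)) ∨
        ∃ a : Node (tensor γ (tensor unit γ')) j ⊕ Node δ j, x = a.map s _root_.id ∧
          NCPart.stack (Hom.level e j).rel (Hom.level g j).rel (NCPart.outer x) (.inr a) := by
      rintro (x | x)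
      · rcases node_triple_cases x with ⟨a, rfl⟩ | ⟨a, rfl⟩
        · exact .inl ⟨a, rfl⟩
        · exact .inr ⟨.inl a, rfl, stack_top (x := .inl _) (y := .inr _) (hs a)⟩
      · exact .inr ⟨.inr x, rfl, Setoid.refl' _ _⟩
    rcases cases x with ⟨a, rfl⟩ | ⟨a, rfl, ha⟩
    · obtain ⟨b, rfl⟩ := hj _ _ hxy
      exact stack_top (x := .inl _) (y := .inl _) (hm a b ((hu a b).2 hxy))
    · rcases cases y with ⟨b, rfl⟩ | ⟨b, rfl, hb⟩
      · obtain ⟨c, hc⟩ := hj _ _ (Setoid.symm' _ hxy)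
        rcases a with a | a
        · exact absurd (Sum.inl_injective hc).symm (mid_node_ne_sides_node _ _)
        · cases hc
      · exact Setoid.trans' _ ha (Setoid.trans' _ (stack_bot ((hg a b).2 hxy))
          (Setoid.symm' _ hb))
  · intro hxy
    -- With the middle row read as surviving upper points, the relation of `f` becomes an
    -- equivalence relation on the stack containing both diagrams.
    have := stack_le ((Hom.level f j).rel.comap (Sum.elim Sum.inl (Sum.map s _root_.id))) ?_ ?_ hxy
    · rcases x with x | x <;> rcases y with y | y <;> exact this
    · intro x y hxy
      have := he _ _ hxy
      rcases x with x | x <;> rcases y with y | y <;> exact this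
    · exact fun x y hxy => (hg x y).1 hxy

/-! ### Convex blocks -/

theorem Before.exists_last {A B : Type} [LinearOrder A] [LinearOrder B] [Finite A] [Finite B]
    (P : A ⊕ B → Prop) (h : ∃ x, P x) : ∃ x, P x ∧ ∀ z, P z → ¬ Before x z := by
  have : IsTrans (A ⊕ B) (fun x y => Before y x) := ⟨fun _ _ _ h h' => h'.trans h⟩
  have : Std.Irrefl (fun x y : A ⊕ B => Before y x) := ⟨fun _ h => h.asymm h⟩
  obtain ⟨x, hx, h'⟩ := (Finite.wellFounded_of_trans_of_irrefl
    (fun x y : A ⊕ B => Before y x)).has_min {x | P x} h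
  exact ⟨x, hx, h'⟩

theorem Before.exists_first {A B : Type} [LinearOrder A] [LinearOrder B] [Finite A] [Finite B]
    (P : A ⊕ B → Prop) (h : ∃ x, P x) : ∃ x, P x ∧ ∀ z, P z → ¬ Before z x := by
  have : IsTrans (A ⊕ B) Before := ⟨fun _ _ _ h h' => h.trans h'⟩
  have : Std.Irrefl (Before : A ⊕ B → A ⊕ B → Prop) := ⟨fun _ h => h.asymm h⟩
  obtain ⟨x, hx, h'⟩ := (Finite.wellFounded_of_trans_of_irrefl
    (Before : A ⊕ B → A ⊕ B → Prop)).has_min {x | P x} h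
  exact ⟨x, hx, h'⟩

/-- A non-empty non-crossing partition has a block without gaps. -/
theorem NCPart.exists_convex_block {A B : Type} [LinearOrder A] [LinearOrder B] [Finite A]
    [Finite B] [Nonempty (A ⊕ B)] (p : NCPart A B) :
    ∃ y, ∀ w x z, p.rel y w → p.rel y z → Before w x → Before x z → p.rel y x := by
  have last : ∀ x, ∃ y, p.rel x y ∧ ∀ z, p.rel x z → ¬ Before y z := fun x =>
    Before.exists_last _ ⟨x, p.rel.refl x⟩
  -- Every block has a last point along the walk; `y` is the earliest of these last points.
  obtain ⟨y, hy, hmin⟩ := Before.exists_first (fun y => ∀ z, p.rel y z → ¬ Before y z) (by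
    obtain ⟨x⟩ := ‹Nonempty (A ⊕ B)›
    obtain ⟨y, hxy, hy⟩ := last x
    exact ⟨y, fun z hz => hy z (p.rel.trans hxy hz)⟩)
  refine ⟨y, fun w x z hw hz hwx hxz => ?_⟩
  have hxy : Before x y := by
    rcases Before.trichotomy z y with h | rfl | h
    · exact hxz.trans h
    · exact hxz
    · exact absurd h (hy z hz)
  obtain ⟨v, hxv, hv⟩ := last x
  -- The block of `x` cannot end before `y` by the choice of `y`. If it ends after `y`, then `w, x,
  -- y, v` would be a crossing unless the two blocks coincide.
  rcases Before.trichotomy v y with h | rfl | h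
  · exact absurd h (hmin v fun t ht => hv t (p.rel.trans hxv ht))
  · exact p.rel.symm hxv
  · exact p.rel.trans hw (p.noncrossing w x y v hwx hxy h (p.rel.symm hw) hxv)

/-! ### The points of the outermost level -/

section ix

variable {γ δ : Obj (k + 1)}

/-- The position of an outermost ellipse. -/
def ix (x : Node γ 0) : ℕ := x.1.headI

theorem val_eq_ix (x : Node γ 0) : x.1 = [ix x] := by
  obtain ⟨i, t, hx, ht⟩ := x.exists_cons
  obtain rfl := List.length_eq_zero_iff.1 ht
  rw [ix, hx]
  rfl

theorem ix_lt_width (x : Node γ 0) : ix x < γ.width := by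
  have h := x.2.2
  rw [val_eq_ix] at h
  exact h.lt_width

theorem ix_injective : Function.Injective (ix : Node γ 0 → ℕ) := fun x y h =>
  Subtype.ext (by rw [val_eq_ix, val_eq_ix, h])

theorem ix_lt_ix {x y : Node γ 0} : ix x < ix y ↔ x < y := by
  change _ ↔ x.1 < y.1
  rw [val_eq_ix x, val_eq_ix y, List.cons_lt_cons_iff]
  simp

theorem exists_ix {i : ℕ} (h : i < γ.width) : ∃ x : Node γ 0, ix x = i :=
  ⟨⟨[i], rfl, γ.tubes[i]'h, List.getElem?_eq_getElem h, .inl rfl⟩, rfl⟩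

instance : Finite (Node γ 0) :=
  Finite.of_injective (fun x : Node γ 0 => (⟨ix x, ix_lt_width x⟩ : Fin γ.width))
    fun _ _ h => ix_injective (congrArg Fin.val h)

theorem ix_mid {ε : Obj (k + 1)} (x : Node ε 0) :
    ix ((Emb.mid γ ε δ).node x) = γ.width + ix x := rfl

theorem width_tensor : (tensor γ δ).width = γ.width + δ.width :=
  List.length_append (as := γ.tubes) (bs := δ.tubes)

theorem exists_tensor_eq {a : ℕ} (h : a ≤ γ.width) :
    ∃ γ₁ γ₂ : Obj (k + 1), γ = tensor γ₁ γ₂ ∧ γ₁.width = a :=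
  ⟨mk (γ.tubes.take a), mk (γ.tubes.drop a), (List.take_append_drop a γ.tubes).symm,
    List.length_take_of_le h⟩

end ix

/-! ### Gapless sets of positions in a row -/

theorem exists_interval {S : Set ℕ} {m : ℕ} (hS : S.Nonempty) (hm : ∀ i ∈ S, i < m)
    (hc : ∀ i ∈ S, ∀ j ∈ S, ∀ z, i < z → z < j → z ∈ S) :
    ∃ a n, 0 < n ∧ a + n ≤ m ∧ ∀ i, i ∈ S ↔ a ≤ i ∧ i < a + n := by
  have hb : BddAbove S := ⟨m, fun i hi => (hm i hi).le⟩
  have h1 := Nat.sInf_mem hS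
  have h2 := Nat.sSup_mem hS hb
  have h3 : ∀ i ∈ S, sInf S ≤ i := fun i hi => Nat.sInf_le hi
  have h4 : ∀ i ∈ S, i ≤ sSup S := fun i hi => le_csSup hb hi
  have h5 := h4 _ h1
  refine ⟨sInf S, sSup S + 1 - sInf S, by omega, by have := hm _ h2; omega, fun i => ⟨fun hi => ?_,
    fun hi => ?_⟩⟩
  · have := h3 i hi; have := h4 i hi; omega
  · rcases hi.1.eq_or_lt with h | h
    · exact h ▸ h1
    · rcases (show i ≤ sSup S by omega).eq_or_lt with h' | h'
      · exact h' ▸ h2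
      · exact hc _ h1 _ h2 _ h h'

/-- Serves a block that meets both rows: having no gaps along the walk, it continues to the right
end of each row. -/
theorem exists_tail {S : Set ℕ} {m : ℕ} (hS : S.Nonempty) (hm : ∀ i ∈ S, i < m)
    (hc : ∀ i ∈ S, ∀ z, i < z → z < m → z ∈ S) :
    ∃ a, a < m ∧ ∀ i, i ∈ S ↔ a ≤ i ∧ i < m := by
  have h1 := Nat.sInf_mem hS
  refine ⟨sInf S, hm _ h1, fun i => ⟨fun hi => ⟨Nat.sInf_le hi, hm _ hi⟩, fun hi => ?_⟩⟩
  rcases hi.1.eq_or_lt with h | h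
  · exact h ▸ h1
  · exact hc _ h1 _ h hi.2

/-! ### Induction on the number of outermost ellipses -/

theorem generated_of_block_zero {γ δ : Obj (k + 1)} (f : γ ⟶ δ)
    (h : ∀ x y, (Hom.level f 0).rel x y) : Generated (IsGenerator k) f := by
  obtain ⟨φ, rfl⟩ := exists_eq_singleBlock f h
  exact generated_singleBlock φ

/-- A morphism with a gapless block in the upper row is generated if a shorter one is. -/
theorem exists_cut {γ δ : Obj (k + 1)} (f : γ ⟶ δ) (y : Node γ 0 ⊕ Node δ 0)
    (hc : ∀ w x z, (Hom.level f 0).rel y w → (Hom.level f 0).rel y z → Before w x → Before x z →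
      (Hom.level f 0).rel y x)
    (hy : ∀ z, (Hom.level f 0).rel y z → ∃ x, z = .inl x) :
    ∃ (γ' : Obj (k + 1)) (g : γ' ⟶ δ), γ'.width < γ.width ∧
      (Generated (IsGenerator k) g → Generated (IsGenerator k) f) := by
  obtain ⟨a, n, hn, han, hS⟩ := exists_interval
    (S := {i | ∃ x : Node γ 0, (Hom.level f 0).rel y (.inl x) ∧ ix x = i}) (m := γ.width)
    (by
      obtain ⟨x, rfl⟩ := hy y (Setoid.refl' _ _)
      exact ⟨_, x, Setoid.refl' _ _, rfl⟩)
    (by rintro _ ⟨x, -, rfl⟩; exact ix_lt_width x)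
    (by
      rintro _ ⟨w, hw, rfl⟩ _ ⟨z, hz, rfl⟩ i h1 h2
      obtain ⟨x, rfl⟩ := exists_ix (h2.trans (ix_lt_width z))
      exact ⟨x, hc _ (.inl x) _ hw hz (ix_lt_ix.1 h1) (ix_lt_ix.1 h2), rfl⟩)
  -- The upper row is cut into `γ₁ ⊗ (ε ⊗ γ₂)`, where `ε` consists of the tubes of the block of `y`.
  obtain ⟨γ₁, γ', rfl, rfl⟩ := exists_tensor_eq (γ := γ) (a := a) (by omega)
  obtain ⟨ε, γ₂, rfl, rfl⟩ := exists_tensor_eq (γ := γ') (a := n) (by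
    rw [width_tensor] at han; omega)
  have hS' : ∀ x, (Hom.level f 0).rel y (.inl x) ↔ γ₁.width ≤ ix x ∧ ix x < γ₁.width + ε.width := by
    intro x
    rw [← hS]
    constructor
    · exact fun h => ⟨x, h, rfl⟩
    · rintro ⟨x', h, e⟩
      exact ix_injective e ▸ h
  have hmem : ∀ b, (Hom.level f 0).rel y (.inl ((Emb.mid γ₁ ε γ₂).node b)) := fun b =>
    (hS' _).2 (by rw [ix_mid]; have := ix_lt_width b; omega)
  refine ⟨tensor γ₁ (tensor unit γ₂), f.restrict (Emb.sides γ₁ ε γ₂) (Emb.refl δ), ?_, fun hg => ?_⟩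
  · rw [width_tensor, width_tensor, width_tensor, width_tensor]
    exact Nat.add_lt_add_left (Nat.add_lt_add_right hn _) _
  · rw [eq_cut_comp f]
    · refine .comp (.tensor (generated_id _) (.tensor (generated_of_block_zero _ ?_)
        (generated_id _))) hg
      rintro (b | b) (b' | b')
      · exact Setoid.trans' (Hom.level f 0).rel (Setoid.symm' _ (hmem b)) (hmem b')
      all_goals first | exact b.isEmpty_unit.elim | exact b'.isEmpty_unit.elim
    · intro b z hz
      have hz := Setoid.trans' _ (hmem b) hz
      obtain ⟨x, rfl⟩ := hy z hz
      have := (hS' x).1 hz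
      obtain ⟨c, hc⟩ := exists_ix (γ := ε) (i := ix x - γ₁.width) (by omega)
      refine ⟨c, congrArg Sum.inl (ix_injective ?_)⟩
      rw [ix_mid, hc]
      omega

theorem before_swap {A B : Type} [LinearOrder A] [LinearOrder B] {x y : A ⊕ B} (h : Before x y) :
    Before y.swap x.swap := by
  rcases x with x | x <;> rcases y with y | y <;> simp_all [Before]

/-- Every morphism of `C_{k+1}` is generated, by induction on the number of outermost ellipses. -/
theorem generated_of_width_le : ∀ (N : ℕ) {γ δ : Obj (k + 1)} (f : γ ⟶ δ),
    γ.width + δ.width ≤ N → Generated (IsGenerator k) f := by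
  intro N
  induction N with
  | zero =>
    intro γ δ f h
    obtain rfl : γ = unit := List.length_eq_zero_iff.1 (show γ.tubes.length = 0 from by
      change γ.tubes.length + _ ≤ 0 at h; omega)
    obtain rfl : δ = unit := List.length_eq_zero_iff.1 (show δ.tubes.length = 0 from by
      change _ + δ.tubes.length ≤ 0 at h; omega)
    exact generated_unit f
  | succ N ih =>
    intro γ δ f hN
    by_cases h0 : γ.width + δ.width = 0
    · exact ih f (by omega)
    have : Nonempty (Node γ 0 ⊕ Node δ 0) := by
      by_cases h : γ.width = 0
      · obtain ⟨x, -⟩ := exists_ix (γ := δ) (i := 0) (by omega)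
        exact ⟨.inr x⟩
      · obtain ⟨x, -⟩ := exists_ix (γ := γ) (i := 0) (by omega)
        exact ⟨.inl x⟩
    obtain ⟨y, hc⟩ := (Hom.level f 0).exists_convex_block
    by_cases hl : ∃ x, (Hom.level f 0).rel y (.inl x)
    · by_cases hr : ∃ x, (Hom.level f 0).rel y (.inr x)
      · obtain ⟨x, hx⟩ := hl
        obtain ⟨x', hx'⟩ := hr
        -- The walk turns from the upper to the lower row at the right, so a gapless block with
        -- points on both sides of the turn contains everything to the right of its points.
        obtain ⟨a, ha, hS⟩ := exists_tail
          (S := {i | ∃ x : Node γ 0, (Hom.level f 0).rel y (.inl x) ∧ ix x = i}) (m := γ.width)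
          ⟨_, x, hx, rfl⟩ (by rintro _ ⟨x, -, rfl⟩; exact ix_lt_width x) (by
            rintro _ ⟨w, hw, rfl⟩ i h1 h2
            obtain ⟨z, rfl⟩ := exists_ix h2
            exact ⟨z, hc _ (.inl z) _ hw hx' (ix_lt_ix.1 h1) trivial, rfl⟩)
        obtain ⟨b, hb, hT⟩ := exists_tail
          (S := {i | ∃ x : Node δ 0, (Hom.level f 0).rel y (.inr x) ∧ ix x = i}) (m := δ.width)
          ⟨_, x', hx', rfl⟩ (by rintro _ ⟨x, -, rfl⟩; exact ix_lt_width x) (by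
            rintro _ ⟨w, hw, rfl⟩ i h1 h2
            obtain ⟨z, rfl⟩ := exists_ix h2
            exact ⟨z, hc _ (.inr z) _ hx hw trivial (ix_lt_ix.1 h1), rfl⟩)
        obtain ⟨γ₁, γ₂, rfl, rfl⟩ := exists_tensor_eq ha.le
        obtain ⟨δ₁, δ₂, rfl, rfl⟩ := exists_tensor_eq hb.le
        have hR : ∀ c, (Hom.level f 0).rel y (ptR γ₁ δ₁ γ₂ δ₂ c) := by
          rintro (c | c)
          · obtain ⟨z, hz, e⟩ := (hS (ix ((Emb.inr γ₁ γ₂).node c))).2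
              ⟨Nat.le_add_right _ _, ix_lt_width _⟩
            obtain rfl := ix_injective e
            exact hz
          · obtain ⟨z, hz, e⟩ := (hT (ix ((Emb.inr δ₁ δ₂).node c))).2
              ⟨Nat.le_add_right _ _, ix_lt_width _⟩
            obtain rfl := ix_injective e
            exact hz
        have hL : ∀ c, ¬ (Hom.level f 0).rel y (ptL γ₁ δ₁ γ₂ δ₂ c) := by
          rintro (c | c) h
          · exact absurd ((hS (ix ((Emb.inl γ₁ γ₂).node c))).1 ⟨_, h, rfl⟩).1
              (not_le.2 (ix_lt_width c))
          · exact absurd ((hT (ix ((Emb.inl δ₁ δ₂).node c))).1 ⟨_, h, rfl⟩).1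
              (not_le.2 (ix_lt_width c))
        rw [eq_tensorHom f fun c d h => hL c (Setoid.trans' _ (hR d) (Setoid.symm' _ h))]
        -- The left factor has fewer ellipses because the block takes at least one from each row.
        refine .tensor (ih _ (by omega)) (generated_of_block_zero _ fun c d => ?_)
        exact Setoid.trans' (Hom.level f 0).rel (Setoid.symm' _ (hR c)) (hR d)
      · obtain ⟨γ', g, hw, hg⟩ := exists_cut f y hc fun z hz => by
          rcases z with z | z
          · exact ⟨z, rfl⟩
          · exact absurd ⟨z, hz⟩ hr
        exact hg (ih g (by omega))
    -- The block lies in the lower row. Reflection brings it to the upper row and reverses the walk,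
    -- which preserves the absence of gaps.
    · obtain ⟨δ', g, hw, hg⟩ := exists_cut (adjoint f) y.swap
        (by
          intro w x z hw hz hwx hxz
          rw [adjoint_rel, Sum.swap_swap] at hw hz ⊢
          exact hc _ _ _ hz hw (before_swap hxz) (before_swap hwx)) fun z hz => by
          rw [adjoint_rel, Sum.swap_swap] at hz
          rcases z with z | z
          · exact ⟨z, rfl⟩
          · exact absurd ⟨z, hz⟩ hl
      rw [← adjoint_adjoint f]
      exact .adj (hg (ih g (by omega)))

end Tubular

theorem mainTheorem2 (k : ℕ) (hk : 1 ≤ k) (γ δ : Tubular.Obj (k + 1)) (f : γ ⟶ δ) :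
    Tubular.Generated (Tubular.IsGenerator k) f :=
  Tubular.generated_of_width_le _ f le_rfl
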